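/- A represented space $\mathbf X=(X,\delta_X)$ is a set $X$ with a partial surjection $\delta_X:\subseteq\mathbb N^{\mathbb N}\to X$; products and coproducts of represented spaces are formed as usual by pairing names and by prefixing names with $0$ or $1$. For partial multi-valued functions $f:\subseteq\mathbf X\rightrightarrows\mathbf Y$ and $g:\subseteq\mathbf U\rightrightarrows\mathbf V$ between represented spaces, write $f\leq_{\mathrm W} g$ (Weihrauch reducibility) if there are computable $K,H:\subseteq\mathbb N^{\mathbb N}\to\mathbb N^{\mathbb N}$ such that $K\langle \mathrm{id},GH\rangle$ is a realizer of $f$ for every realizer $G$ of $g$. The Weihrauch degrees $\mathcal W$ are the equivalence classes of partial multi-valued functions under mutual reducibility, with an additional top element $\infty$; $0$ is the degree of the nowhere defined function and $1$ the degree of the identity of a one-point space. Composition is $z\in(f\circ g)(x)$ iff $g(x)\subseteq\operatorname{dom}(f)$ and $z\in f(y)$ for some $y\in g(x)$. The operations on degrees are induced by the following ones: - $(f\times g)(x,u)=f(x)\times g(u)$; $f\sqcup g$ on $\mathbf X\sqcup\mathbf U$ is $(0,x)\mapsto\{0\}\times f(x)$, $(1,u)\mapsto\{1\}\times g(u)$;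 and $(f\sqcap g)(x,u)=\{0\}\times f(x)\cup\{1\}\times g(u)$ with domain $\operatorname{dom}(f)\times\operatorname{dom}(g)$. - $\mathcal M(\mathbf Y,\mathbf Z)$ is the represented space of strongly continuous multi-valued functions: $p\in\mathbb N^{\mathbb N}$ names $\delta_Z\circ\Phi_p\circ(\delta_Y^{\mathrm{cyl}})^{-1}$, where $\Phi_p$ is the partial function on $\mathbb N^{\mathbb N}$ computed by a fixed universal machine with program $p$ and $\delta_Y^{\mathrm{cyl}}\langle p,q\rangle=\delta_Y(p)$. For $f:\subseteq\mathbf U\rightrightarrows\mathbf V$ and $g:\subseteq\mathbf X\rightrightarrows\mathbf Y$, the compositional product is $f\star g:\subseteq\mathcal M(\mathbf Y,\mathbb N^{\mathbb N}\times\mathbf U)\times\mathbf X\rightrightarrows\mathbb N^{\mathbb N}\times\mathbf V$, $(f\star g)(h,x)=\big((\mathrm{id}\times f)\circ (h\circ g)\big)(x)$, more precisely $(\mathrm{id}\times f)\circ g^{\mathrm t}$ with $g^{\mathrm t}(h,x)=(h\circ g)(x)$. - For the same $f,g$, the implication $(g\to f):\subseteq\mathbf U\rightrightarrows\mathcal M(\mathbf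 Y,\mathbf V)\times\mathbf X$ is given by $(H,x)\in(g\to f)(u)$ iff $\emptyset\neq (H\circ g)(x)\subseteq f(u)$, except that $(g\to f)=\infty$ if $\operatorname{dom}(g)=\emptyset\neq\operatorname{dom}(f)$. - For every degree $\mathbf a$: $\mathbf a\times\infty=\infty\times\mathbf a=\mathbf a\star\infty=\infty\star\mathbf a=\mathbf a\sqcup\infty=\infty\sqcup\mathbf a=\infty$, $\mathbf a\sqcap\infty=\infty\sqcap\mathbf a=\mathbf a$, $(\infty\to\mathbf a)=0$, and $(\mathbf a\to\infty)=\infty$ if $\mathbf a\neq\infty$. **Proposition.** For all Weihrauch degrees $\mathbf a,\mathbf b,\mathbf c,\mathbf d\in\mathcal W$: 1. $\mathbf a\to(\mathbf b\to\mathbf c)=(\mathbf b\star\mathbf a)\to\mathbf c$; 2. $\mathbf a\to(\mathbf b\star\mathbf c)\leq_{\mathrm W}(\mathbf a\to\mathbf b)\star\mathbf c$; 3. $(\mathbf a\sqcup\mathbf b)\to\mathbf c\leq_{\mathrm W}(\mathbf a\to\mathbf c)\sqcap(\mathbf b\to\mathbf c)$; 4. $(\mathbf a\to\mathbf c)\sqcup(\mathbf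 b\to\mathbf c)\leq_{\mathrm W}(\mathbf a\sqcap\mathbf b)\to\mathbf c$; 5. $\mathbf a\times(\mathbf b\star\mathbf c)\leq_{\mathrm W}\big(\mathbf b\star(\mathbf a\times\mathbf c)\big)\sqcap\big((\mathbf a\times\mathbf b)\star\mathbf c\big)$; 6. $(\mathbf a\star\mathbf c)\times(\mathbf b\star\mathbf d)\leq_{\mathrm W}(\mathbf a\times\mathbf b)\star(\mathbf c\times\mathbf d)$; 7. $(\mathbf a\star\mathbf c)\sqcap(\mathbf b\star\mathbf d)\leq_{\mathrm W}(\mathbf a\sqcap\mathbf b)\star(\mathbf c\times\mathbf d)$, provided that $\mathbf a$ and $\mathbf b$ are both different from $\infty$ or both equal to $\infty$; 8. $(\mathbf a\to1)\star\mathbf b=(\mathbf a\to1)\times\mathbf b$; 9. $(\mathbf a\sqcap1)\to1=\mathbf a\to1$ if $\mathbf a\neq\infty$. None of the six reductions in (2)–(7) can be replaced by an equality in general: for each of them there are degrees different from $0$ and $\infty$ for which the converse reduction fails. -/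

import Mathlib

namespace Weihrauch

/-! ## Baire space and its computable partial functions -/

/-- Baire space `ℕ^ℕ`. -/
abbrev Baire : Type := ℕ → ℕ

/-- The standard pairing `⟨p, q⟩` on Baire space, by interleaving. -/
def pair (p q : Baire) : Baire := fun n => if n % 2 = 0 then p (n / 2) else q (n / 2)

/-- First projection of the pairing. -/
def fstB (r : Baire) : Baire := fun n => r (2 * n)

/-- Second projection of the pairing. -/
def sndB (r : Baire) : Baire := fun n => r (2 * n + 1)

/-- The sequence without its first entry. -/
def tailB (r : Baire) : Baire := fun n => r (n + 1)

/-- The first `k` entries of `q`. -/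
def initSeg (q : Baire) (k : ℕ) : List ℕ := (List.range k).map q

/-- The entry of the program `p` at (a code of) the pair of `n` and the first `k` entries of `q`. -/
def look (p q : Baire) (n k : ℕ) : ℕ := p (Encodable.encode ((n, initSeg q k) : ℕ × List ℕ))

/-- The partial function `Φ_p` computed by a fixed universal machine with program `p`.
On input `⟨p, q⟩` the machine writes, for `n = 0, 1, 2, …` in turn, one output symbol: it searches
for the least `k` with `look p q n k ≠ 0` and writes `look p q n k - 1`.  The input `q` is in the
domain iff infinitely many symbols get written, i.e. iff every search succeeds.
The machine is universal: for an oracle machine `M` with parameter `s` put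
`p (n, w) = v + 1` if `M`, run for `length w` steps and reading only the part `w` of its input,
has written an `n`-th symbol and that symbol is `v`, and `p (n, w) = 0` otherwise; then `Φ_p` is
the function computed by `M` with parameter `s`, with the same domain, and `p` is computable
from `s` (uniformly). -/
def Phi (p : Baire) : Baire →. Baire := fun q =>
  ⟨∀ n, ∃ k, look p q n k ≠ 0, fun h n => look p q n (Nat.find (h n)) - 1⟩

/-- A partial function on Baire space is computable if some machine with a computable program
computes it at all points of its domain. -/
def IsComputable (F : Baire →. Baire) : Prop :=
  ∃ p : Baire, Computable p ∧ ∀ q r, r ∈ F q → r ∈ Phi p q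

/-! ## Represented spaces -/

/-- A represented space: a set with a partial surjection `δ` from Baire space.
(Such a set has at most the cardinality of the continuum, so `Type` is no restriction.) -/
structure RepSpace where
  carrier : Type
  δ : Baire →. carrier
  surj : ∀ x, ∃ p, x ∈ δ p

/-- Baire space, represented by the identity. -/
def baireSpace : RepSpace where
  carrier := Baire
  δ := fun p => Part.some p
  surj := fun x => ⟨x, Part.mem_some x⟩

/-- The one-point space, with a total representation. -/
def oneSpace : RepSpace where
  carrier := Unit
  δ := fun _ => Part.some ()
  surj := fun x => ⟨fun _ => 0, Part.mem_some x⟩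

theorem fstB_pair (p q : Baire) : fstB (pair p q) = p := by
  funext n; simp [fstB, pair]

theorem sndB_pair (p q : Baire) : sndB (pair p q) = q := by
  funext n
  have h : (2 * n + 1) / 2 = n := by omega
  simp [sndB, pair, h]

/-- The product of represented spaces: `δ ⟨p, q⟩ = (δ_X p, δ_Y q)`. -/
def prodSpace (X Y : RepSpace) : RepSpace where
  carrier := X.carrier × Y.carrier
  δ := fun r => (X.δ (fstB r)).bind fun x => (Y.δ (sndB r)).map fun y => (x, y)
  surj := by
    rintro ⟨x, y⟩
    obtain ⟨p, hp⟩ := X.surj x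
    obtain ⟨q, hq⟩ := Y.surj y
    refine ⟨pair p q, ?_⟩
    rw [fstB_pair, sndB_pair]
    exact Part.mem_bind hp (Part.mem_map _ hq)

/-- The coproduct of represented spaces: `δ (0p) = (0, δ_X p)` and `δ (1p) = (1, δ_Y p)`. -/
def sumSpace (X Y : RepSpace) : RepSpace where
  carrier := X.carrier ⊕ Y.carrier
  δ := fun r =>
    if r 0 = 0 then (X.δ (tailB r)).map Sum.inl
    else if r 0 = 1 then (Y.δ (tailB r)).map Sum.inr
    else Part.none
  surj := by
    rintro (x | y)
    · obtain ⟨p, hp⟩ := X.surj x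
      refine ⟨fun n => Nat.casesOn n 0 p, ?_⟩
      exact Part.mem_map _ hp
    · obtain ⟨p, hp⟩ := Y.surj y
      refine ⟨fun n => Nat.casesOn n 1 p, ?_⟩
      exact Part.mem_map _ hp

/-! ## Multi-valued functions -/

/-- Partial multi-valued functions `f :⊆ X ⇉ Y`, as relations; `x` is in the domain
iff `f x` is non-empty. -/
abbrev MultiFun (X Y : RepSpace) : Type := X.carrier → Set Y.carrier

/-- The domain of a multi-valued function. -/
def MultiFun.dom {X Y : RepSpace} (f : MultiFun X Y) : Set X.carrier := {x | (f x).Nonempty}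

/-- Composition of multi-valued functions: `x` is in the domain of `f ∘ g` only if all values
of `g` at `x` are in the domain of `f`. -/
def MultiFun.comp {X Y Z : RepSpace} (f : MultiFun Y Z) (g : MultiFun X Y) : MultiFun X Z :=
  fun x => {z | (∀ y ∈ g x, y ∈ f.dom) ∧ ∃ y ∈ g x, z ∈ f y}

/-- The product `f × g`. -/
def MultiFun.prod {X Y U V : RepSpace} (f : MultiFun X Y) (g : MultiFun U V) :
    MultiFun (prodSpace X U) (prodSpace Y V) :=
  fun a => {b | b.1 ∈ f a.1 ∧ b.2 ∈ g a.2}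

/-- The coproduct `f ⊔ g`. -/
def MultiFun.coprod {X Y U V : RepSpace} (f : MultiFun X Y) (g : MultiFun U V) :
    MultiFun (sumSpace X U) (sumSpace Y V) :=
  fun a => Sum.elim (fun x => Sum.inl '' f x) (fun u => Sum.inr '' g u) a

/-- The meet `f ⊓ g`, with domain `dom f × dom g`. -/
def MultiFun.meet {X Y U V : RepSpace} (f : MultiFun X Y) (g : MultiFun U V) :
    MultiFun (prodSpace X U) (sumSpace Y V) :=
  fun a => {b | a.1 ∈ f.dom ∧ a.2 ∈ g.dom ∧ b ∈ (Sum.inl '' f a.1 ∪ Sum.inr '' g a.2)}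

/-- The identity on Baire space. -/
def idBaire : MultiFun baireSpace baireSpace := fun p => {p}

/-- The names of `x` under the cylindrification of the representation of `X`. -/
def cylNames (X : RepSpace) (x : X.carrier) : Set Baire := {q | x ∈ X.δ (fstB q)}

/-- The strongly continuous multi-valued function `Φ_p^{X,Y} = δ_Y ∘ Φ_p ∘ (δ_X^cyl)⁻¹`. -/
def PhiMulti (X Y : RepSpace) (p : Baire) : MultiFun X Y :=
  fun x => {y | (∀ q ∈ cylNames X x, ∃ r ∈ Phi p q, (Y.δ r).Dom) ∧
    ∃ q ∈ cylNames X x, ∃ r ∈ Phi p q, y ∈ Y.δ r}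

/-- The represented space `M(X, Y)` of strongly continuous multi-valued functions;
`p` is a name of `Φ_p^{X,Y}`. -/
def funSpace (X Y : RepSpace) : RepSpace where
  carrier := {f : MultiFun X Y // ∃ p, f = PhiMulti X Y p}
  δ := fun p => Part.some ⟨PhiMulti X Y p, p, rfl⟩
  surj := by
    rintro ⟨f, p, rfl⟩
    exact ⟨p, Part.mem_some _⟩

/-- The transposition `g^t_U :⊆ M(Y, U) × X ⇉ U`, `(h, x) ↦ (h ∘ g)(x)`. -/
def MultiFun.transp {X Y : RepSpace} (g : MultiFun X Y) (U : RepSpace) :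
    MultiFun (prodSpace (funSpace Y U) X) U :=
  fun a => MultiFun.comp a.1.1 g a.2

/-- The compositional product `f ⋆ g = (id × f) ∘ g^t`, where the transposition of `g` is taken
with respect to the product of Baire space and the source of `f`. -/
def MultiFun.star {U V X Y : RepSpace} (f : MultiFun U V) (g : MultiFun X Y) :
    MultiFun (prodSpace (funSpace Y (prodSpace baireSpace U)) X) (prodSpace baireSpace V) :=
  MultiFun.comp (MultiFun.prod idBaire f) (g.transp (prodSpace baireSpace U))

/-- The multi-valued function `g → f :⊆ U ⇉ M(Y, V) × X`: a pair `(H, x)` is a solution for `u`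
iff `H ∘ g` is defined at `x` and all its values there are in `f u`.
(Used if `dom g` is non-empty or `dom f` is empty; then its domain is the domain of `f`.) -/
def MultiFun.impl {X Y U V : RepSpace} (g : MultiFun X Y) (f : MultiFun U V) :
    MultiFun U (prodSpace (funSpace Y V) X) :=
  fun u => {a | (MultiFun.comp a.1.1 g a.2).Nonempty ∧ MultiFun.comp a.1.1 g a.2 ⊆ f u}

/-! ## Weihrauch reducibility -/

/-- A partial function `G` on Baire space realizes `f`. -/
def Realizes {X Y : RepSpace} (G : Baire →. Baire) (f : MultiFun X Y) : Prop :=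
  ∀ p, ∀ x ∈ X.δ p, x ∈ f.dom → ∃ q ∈ G p, ∃ y ∈ Y.δ q, y ∈ f x

/-- Weihrauch reducibility: there are computable `K`, `H` such that `K ⟨id, G H⟩` realizes `f`
whenever `G` realizes `g`. -/
def Reducible {X Y U V : RepSpace} (f : MultiFun X Y) (g : MultiFun U V) : Prop :=
  ∃ K H : Baire →. Baire, IsComputable K ∧ IsComputable H ∧
    ∀ G : Baire →. Baire, Realizes G g →
      Realizes (fun p => (H p).bind fun a => (G a).bind fun b => K (pair p b)) f

/-! ## Representatives of Weihrauch degrees, including the top degree -/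

/-- Representatives of the Weihrauch degrees: multi-valued functions between represented spaces
and the additional top element `∞`. -/
inductive Problem : Type 1
  | mf {X Y : RepSpace} (f : MultiFun X Y) : Problem
  | infty : Problem

namespace Problem

/-- The reducibility `a ≤ b` of degrees, on representatives, with `∞` as strict top. -/
def le : Problem → Problem → Prop
  | _, infty => True
  | infty, mf _ => False
  | mf f, mf g => Reducible f g

/-- Equality of degrees, on representatives. -/
def equiv (a b : Problem) : Prop := le a b ∧ le b a

/-- The degree `1`, represented by the identity of the one-point space. -/
def one : Problem := mf (X := oneSpace) (Y := oneSpace) fun x => {x}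

/-- The degree `0`, represented by a nowhere defined multi-valued function. -/
def zero : Problem := mf (X := oneSpace) (Y := oneSpace) fun _ => ∅

/-- The product, with `a × ∞ = ∞ × a = ∞`. -/
def prod : Problem → Problem → Problem
  | mf f, mf g => mf (f.prod g)
  | infty, _ => infty
  | mf _, infty => infty

/-- The coproduct (supremum), with `a ⊔ ∞ = ∞ ⊔ a = ∞`. -/
def coprod : Problem → Problem → Problem
  | mf f, mf g => mf (f.coprod g)
  | infty, _ => infty
  | mf _, infty => infty

/-- The meet (infimum), with `a ⊓ ∞ = ∞ ⊓ a = a`. -/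
def meet : Problem → Problem → Problem
  | mf f, mf g => mf (f.meet g)
  | infty, b => b
  | mf f, infty => mf f

/-- The compositional product, with `a ⋆ ∞ = ∞ ⋆ a = ∞`. -/
def star : Problem → Problem → Problem
  | mf f, mf g => mf (f.star g)
  | infty, _ => infty
  | mf _, infty => infty

open Classical in
/-- The implication `g → f`: it is `∞` if `dom g` is empty and `dom f` is not; moreover
`(∞ → a) = 0`, and `(g → ∞) = ∞` for `g ≠ ∞`. -/
noncomputable def impl : Problem → Problem → Problem
  | mf g, mf f => if g.dom = ∅ ∧ f.dom ≠ ∅ then infty else mf (g.impl f)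
  | infty, _ => zero
  | mf _, infty => infty

/-- The problem represents a degree different from `0` and `∞`: it is a multi-valued function
with non-empty domain. -/
def Proper : Problem → Prop
  | mf f => f.dom.Nonempty
  | infty => False

end Problem

end Weihrauch

infix:50 " ≤w " => Weihrauch.Problem.le
infix:50 " ≡w " => Weihrauch.Problem.equiv
infixr:60 " →w " => Weihrauch.Problem.impl
infixl:65 " ⊔w " => Weihrauch.Problem.coprod
infixl:65 " ⊓w " => Weihrauch.Problem.meet
infixl:70 " ×w " => Weihrauch.Problem.prod
infixl:70 " ⋆w " => Weihrauch.Problem.star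

namespace Weihrauch

/-! ## Computable functionals via finite approximations -/

/-! The proof passes from represented spaces to names. `names f` relates an instance name to all
names of its solutions. By `reducible_iff`, reducibility depends only on this relation: a realizer
is an arbitrary choice of solutions, so it may be altered at the one query that a reduction makes.
On names an instance of f ⋆ g is a program together with an instance of g; the program turns a
solution of g into side information and an instance of f. A solution of g → f is a program and an
instance of g such that the program turns every solution of that instance into the required one
(`names_star`, `names_impl`).

The reductions then become explicit rearrangements of programs. They need computability of the
universal function (`isComputable_universal`), closure under composition and pairing, and the smn
theorem (`IsComputable.exists_curry`). All of these come from `Approx`, the description of a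
computable functional by finite approximations. The law for iterated implications is currying, with
the Baire factor of ⋆ carrying the inner program. The distributive laws run two programs in
parallel, or pass data through that factor. The laws about → 1 hold because a solution of a → 1
amounts to a name of a point in dom a, which is independent of the instance. Empty domains and ∞ are
treated separately in the lemmas on `Problem`.

Each converse is refuted by problems whose solutions are single points of Baire space or whose
domains are single points. By `NameReducible.computableFrom`, a computable instance leads to a
computable query, and every answer to it computes a solution. The points are chosen non-computable
or Turing incomparable, by counting and by Baire category, so that some answer is too weak. -/

theorem length_initSeg (q : Baire) (k : ℕ) : (initSeg q k).length = k := by simp [initSeg]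

theorem initSeg_getElem? (q : Baire) (k i : ℕ) :
    (initSeg q k)[i]? = if i < k then some (q i) else none := by
  unfold initSeg
  split_ifs with h
  · simp [h]
  · simp; omega

theorem initSeg_prefix (q : Baire) {k l : ℕ} (h : k ≤ l) : initSeg q k <+: initSeg q l := by
  rw [List.prefix_iff_eq_take]
  apply List.ext_getElem?
  intro i
  rw [length_initSeg, List.getElem?_take, initSeg_getElem?, initSeg_getElem?]
  split_ifs <;> first | rfl | omega

theorem look_eq (p q : Baire) (n k : ℕ) :
    look p q n k = p (Encodable.encode ((n, initSeg q k) : ℕ × List ℕ)) := rfl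

theorem mem_Phi_iff {p q r : Baire} :
    r ∈ Phi p q ↔ ∀ n, ∃ k, look p q n k = r n + 1 ∧ ∀ j < k, look p q n j = 0 := by
  constructor
  · rintro ⟨h, rfl⟩ n
    refine ⟨Nat.find (h n), ?_, fun j hj => by simpa using Nat.find_min (h n) hj⟩
    have := Nat.find_spec (h n)
    change _ = look p q n (Nat.find (h n)) - 1 + 1
    omega
  · intro h
    have hd : ∀ n, ∃ k, look p q n k ≠ 0 := fun n => by
      obtain ⟨k, hk, -⟩ := h n
      exact ⟨k, by omega⟩
    refine ⟨hd, ?_⟩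
    funext n
    obtain ⟨k, hk, hj⟩ := h n
    have : Nat.find (hd n) = k := by
      rw [Nat.find_eq_iff]
      exact ⟨by omega, fun j hjk => by simpa using hj j hjk⟩
    change look p q n (Nat.find (hd n)) - 1 = r n
    rw [this, hk]; rfl

theorem mem_Phi_of {p q r : Baire} (h : ∀ n k, look p q n k = 0 ∨ look p q n k = r n + 1)
    (hd : ∀ n, ∃ k, look p q n k ≠ 0) : r ∈ Phi p q := by
  refine ⟨hd, ?_⟩
  funext n
  have h1 := Nat.find_spec (hd n)
  have h2 := h n (Nat.find (hd n))
  change look p q n (Nat.find (hd n)) - 1 = r n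
  omega

/-- `A` approximates `F`: from longer and longer initial segments of the input, it finds the
entries of the output, and it never changes an entry. -/
structure Approx (A : ℕ → List ℕ → Option ℕ) (F : Baire →. Baire) : Prop where
  comp : Computable₂ A
  mono : ∀ {n w w' v}, w <+: w' → A n w = some v → A n w' = some v
  conv : ∀ {q r}, r ∈ F q → ∀ n, ∃ k, A n (initSeg q k) = some (r n)

theorem Approx.eventually {A F} (h : Approx A F) {q r : Baire} (hr : r ∈ F q) (n : ℕ) :
    ∃ k, ∀ l, k ≤ l → A n (initSeg q l) = some (r n) := by
  obtain ⟨k, hk⟩ := h.conv hr n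
  exact ⟨k, fun l hl => h.mono (initSeg_prefix q hl) hk⟩

theorem Approx.consistent {A F} (h : Approx A F) {q r : Baire} (hr : r ∈ F q) {n k v : ℕ}
    (hv : A n (initSeg q k) = some v) : v = r n := by
  obtain ⟨l, hl⟩ := h.eventually hr n
  have h1 := h.mono (initSeg_prefix q (le_max_left k l)) hv
  rw [hl _ (le_max_right k l)] at h1
  exact (Option.some.inj h1).symm

/-- The encoding of an answer as a program entry. -/
def entry (o : Option ℕ) : ℕ := (o.map Nat.succ).getD 0

theorem computable_entry : Computable entry :=
  Computable.option_getD (Computable.option_map Computable.id (Computable.succ.comp Computable.snd))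
    (Computable.const 0)

theorem computable_ite {α σ : Type*} [Primcodable α] [Primcodable σ] {c : α → Prop}
    [DecidablePred c] {f g : α → σ} (hc : PrimrecPred c) (hf : Computable f) (hg : Computable g) :
    Computable fun a => if c a then f a else g a := by
  have := Computable.cond (c := fun a => decide (c a)) hc.decide.to_comp hf hg
  refine this.of_eq fun a => ?_
  by_cases h : c a <;> simp [h]

/-- The answers of `A`, shifted by one, form the program. Along an input in the domain all answers
for one output place agree, so it does not matter which non-zero entry the machine meets first. -/
theorem Approx.isComputable {A F} (h : Approx A F) : IsComputable F := by
  have hD : Computable (Denumerable.ofNat (ℕ × List ℕ)) := Computable.ofNat _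
  refine ⟨fun m => entry (A (Denumerable.ofNat (ℕ × List ℕ) m).1 (Denumerable.ofNat (ℕ × List ℕ) m).2),
    computable_entry.comp (h.comp.comp (Computable.fst.comp hD) (Computable.snd.comp hD)), ?_⟩
  intro q r hr
  have key : ∀ n k, look (fun m => entry (A (Denumerable.ofNat (ℕ × List ℕ) m).1
      (Denumerable.ofNat (ℕ × List ℕ) m).2)) q n k = entry (A n (initSeg q k)) := by
    intro n k
    rw [look_eq, Denumerable.ofNat_encode]
  refine mem_Phi_of (fun n k => ?_) fun n => ?_
  · rw [key]
    cases e : A n (initSeg q k) with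
    | none => exact Or.inl rfl
    | some v => exact Or.inr (by rw [h.consistent hr e]; rfl)
  · obtain ⟨k, hk⟩ := h.conv hr n
    exact ⟨k, by rw [key, hk]; exact Nat.succ_ne_zero _⟩

/-! ### Searching a partially known program; the universal function -/

/-- Search for the first non-zero entry in a table with unknown entries: `some 0` means that none
was found so far, `none` that an unknown entry was met. -/
def scan (t : ℕ → Option ℕ) : ℕ → Option ℕ
  | 0 => some 0
  | j + 1 => (scan t j).bind fun s => if s = 0 then t j else some s

theorem scan_mono {t t' : ℕ → Option ℕ} (h : ∀ j v, t j = some v → t' j = some v) (m v : ℕ)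
    (hs : scan t m = some v) : scan t' m = some v := by
  induction m generalizing v with
  | zero => exact hs
  | succ m ih =>
    rw [scan, Option.bind_eq_some_iff] at hs ⊢
    obtain ⟨s, h1, h2⟩ := hs
    refine ⟨s, ih _ h1, ?_⟩
    split_ifs at h2 ⊢
    · exact h _ _ h2
    · exact h2

theorem scan_stable (t : ℕ → Option ℕ) {m m' v : ℕ} (hm : m ≤ m')
    (hs : scan t m = some (v + 1)) : scan t m' = some (v + 1) := by
  induction m', hm using Nat.le_induction with
  | base => exact hs
  | succ m' _ ih => simp [scan, ih]

theorem scan_found {t : ℕ → Option ℕ} {k v : ℕ} (h0 : ∀ i < k, t i = some 0)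
    (hk : t k = some v) : scan t (k + 1) = some v := by
  have : ∀ j ≤ k, scan t j = some 0 := by
    intro j hj
    induction j with
    | zero => rfl
    | succ j ih => simp [scan, ih (by omega), h0 j (by omega)]
  simp [scan, this k le_rfl, hk]

/-- The machine uses the first non-zero entry of its program, and later entries may contradict it.
Hence an answer is safe only when all earlier entries are known to be zero; `scan` waits for them.
The table `t` may come from a fixed program or from one that is itself read from the input. -/
theorem approx_scan {t : (ℕ × List ℕ) × ℕ → Option ℕ} {F : Baire →. Baire} (ht : Computable t)
    (hm : ∀ {n w w' j v}, w <+: w' → t ((n, w), j) = some v → t ((n, w'), j) = some v)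
    (hF : ∀ {q r}, r ∈ F q → ∀ n, ∃ k K, (∀ i < k, t ((n, initSeg q K), i) = some 0) ∧
      t ((n, initSeg q K), k) = some (r n + 1)) :
    Approx (fun n w => (scan (fun j => t ((n, w), j)) w.length).bind fun s =>
      if s = 0 then none else some s.pred) F where
  comp := by
    have hs : Computable fun x : ℕ × List ℕ => scan (fun j => t (x, j)) x.2.length := by
      have hrec := Computable.nat_rec (α := ℕ × List ℕ) (σ := Option ℕ)
        (f := fun x => x.2.length) (g := fun _ => some 0)
        (h := fun x y => y.2.bind fun s => if s = 0 then t (x, y.1) else some s)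
        (Computable.list_length.comp Computable.snd) (Computable.const _) ?_
      · refine hrec.of_eq fun x => ?_
        induction x.2.length with
        | zero => rfl
        | succ m ih => simp only [scan, ← ih]
      · refine Computable.option_bind (Computable.snd.comp Computable.snd) ?_
        refine computable_ite (c := fun x : ((ℕ × List ℕ) × ℕ × Option ℕ) × ℕ => x.2 = 0)
          (Primrec.eq.comp Primrec.snd (Primrec.const 0))
          (ht.comp (Computable.pair (Computable.fst.comp Computable.fst)
            (Computable.fst.comp (Computable.snd.comp Computable.fst))))
          (Computable.option_some.comp Computable.snd)
    refine Computable.option_bind hs ?_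
    refine computable_ite (c := fun x : (ℕ × List ℕ) × ℕ => x.2 = 0)
      (Primrec.eq.comp Primrec.snd (Primrec.const 0)) (Computable.const _)
      (Computable.option_some.comp (Computable.pred.comp Computable.snd))
  mono := by
    intro n w w' v hw h
    rw [Option.bind_eq_some_iff] at h ⊢
    obtain ⟨s, h1, h2⟩ := h
    refine ⟨s, ?_, h2⟩
    obtain _ | s := s
    · simp at h2
    · exact scan_stable _ hw.length_le (scan_mono (fun j v => hm hw) _ _ h1)
  conv := by
    intro q r hr n
    obtain ⟨k, K, h0, hk⟩ := hF hr n
    -- Length `K` makes the entries up to `k` known; the number of rounds equals the length, and `k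
    -- + 1` rounds are needed to inspect index `k`.
    refine ⟨max K (k + 1), ?_⟩
    have hp := initSeg_prefix q (le_max_left K (k + 1))
    have := scan_found (t := fun j => t ((n, initSeg q (max K (k + 1))), j))
      (fun i hi => hm hp (h0 i hi)) (hm hp hk)
    rw [length_initSeg, scan_stable _ (le_max_right _ _) this]
    rfl

theorem exists_bound (f : ℕ → ℕ) (k : ℕ) : ∃ K, ∀ i ≤ k, f i ≤ K :=
  ⟨(Finset.range (k + 1)).sup f, fun _ hi =>
    Finset.le_sup (f := f) (Finset.mem_range.2 (Nat.lt_succ_of_le hi))⟩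

theorem take_initSeg (q : Baire) {j k : ℕ} (h : j ≤ k) : (initSeg q k).take j = initSeg q j := by
  have := List.prefix_iff_eq_take.1 (initSeg_prefix q h)
  rw [length_initSeg] at this
  exact this.symm

theorem take_of_prefix {w w' : List ℕ} {j : ℕ} (h : w <+: w') (hj : j ≤ w.length) :
    w'.take j = w.take j := by
  obtain ⟨u, rfl⟩ := h
  exact List.take_append_of_le_length hj

theorem getElem?_of_prefix {w w' : List ℕ} {j v : ℕ} (h : w <+: w') (hj : w[j]? = some v) :
    w'[j]? = some v := by
  obtain ⟨u, rfl⟩ := h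
  rw [List.getElem?_append_left (List.getElem?_eq_some_iff.1 hj).1]
  exact hj

theorem IsComputable.exists_approx {F : Baire →. Baire} (h : IsComputable F) :
    ∃ A, Approx A F := by
  obtain ⟨p, hp, hF⟩ := h
  refine ⟨_, approx_scan (t := fun x => if x.2 ≤ x.1.2.length then
    some (p (Encodable.encode (x.1.1, x.1.2.take x.2))) else none) ?_ ?_ ?_⟩
  · refine computable_ite (c := fun x : (ℕ × List ℕ) × ℕ => x.2 ≤ x.1.2.length)
      (Primrec.nat_le.comp Primrec.snd (Primrec.list_length.comp (Primrec.snd.comp Primrec.fst)))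
      (Computable.option_some.comp (hp.comp (Computable.encode.comp (Computable.pair
        (Computable.fst.comp Computable.fst) ?_)))) (Computable.const _)
    exact (Primrec.list_take.comp Primrec.snd (Primrec.snd.comp Primrec.fst)).to_comp
  · intro n w w' j v hw hv
    simp only at hv ⊢
    split_ifs at hv with hj
    rw [if_pos (hj.trans hw.length_le), take_of_prefix hw hj]
    exact hv
  · intro q r hr n
    obtain ⟨k, hk, h0⟩ := mem_Phi_iff.1 (hF q r hr) n
    refine ⟨k, k, fun i hi => ?_, ?_⟩
    · simp only [length_initSeg]
      rw [if_pos hi.le, take_initSeg q hi.le, ← look_eq p q n i, h0 i hi]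
    · simp only [length_initSeg]
      rw [if_pos le_rfl, take_initSeg q le_rfl, ← look_eq p q n k, hk]

theorem primrec_even : PrimrecPred fun n : ℕ => n % 2 = 0 :=
  Primrec.eq.comp (Primrec.nat_mod.comp Primrec.id (Primrec.const 2)) (Primrec.const 0)

/-- The entries with odd indices among the first `2 * j` ones. -/
def oddPart (w : List ℕ) (j : ℕ) : List ℕ := (List.range j).map fun i => w.getD (2 * i + 1) 0

theorem oddPart_initSeg (s : Baire) {j K : ℕ} (h : 2 * j ≤ K) :
    oddPart (initSeg s K) j = initSeg (sndB s) j := by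
  change _ = (List.range j).map (sndB s)
  refine List.map_congr_left fun i hi => ?_
  rw [List.mem_range] at hi
  rw [List.getD_eq_getElem?_getD, initSeg_getElem?, if_pos (by omega)]
  rfl

theorem oddPart_of_prefix {w w' : List ℕ} {j : ℕ} (h : w <+: w') (hj : 2 * j ≤ w.length) :
    oddPart w' j = oddPart w j := by
  refine List.map_congr_left fun i hi => ?_
  rw [List.mem_range] at hi
  obtain ⟨u, rfl⟩ := h
  rw [List.getD_append _ _ _ _ (by omega)]

theorem primrec_oddPart : Primrec₂ oddPart := by
  refine Primrec.list_map (Primrec.list_range.comp Primrec.snd) ?_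
  exact (Primrec.list_getD 0).comp (Primrec.fst.comp Primrec.fst)
    (Primrec.succ.comp (Primrec.nat_mul.comp (Primrec.const 2) Primrec.snd))

/-- The universal function is computable. -/
theorem isComputable_universal : IsComputable fun s => Phi (fstB s) (sndB s) := by
  refine (approx_scan (t := fun x => if 2 * x.2 ≤ x.1.2.length then
    x.1.2[2 * Encodable.encode (x.1.1, oddPart x.1.2 x.2)]? else none) ?_ ?_ ?_).isComputable
  · refine Primrec.to_comp (Primrec.ite (Primrec.nat_le.comp (Primrec.nat_mul.comp
      (Primrec.const 2) Primrec.snd) (Primrec.list_length.comp (Primrec.snd.comp Primrec.fst)))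
      ?_ (Primrec.const _))
    exact Primrec.list_getElem?.comp (Primrec.snd.comp Primrec.fst) (Primrec.nat_mul.comp
      (Primrec.const 2) (Primrec.encode.comp (Primrec.pair (Primrec.fst.comp Primrec.fst)
      (primrec_oddPart.comp (Primrec.snd.comp Primrec.fst) Primrec.snd))))
  · intro n w w' j v hw hv
    simp only at hv ⊢
    split_ifs at hv with hj
    rw [if_pos (hj.trans hw.length_le), oddPart_of_prefix hw hj]
    exact getElem?_of_prefix hw hv
  · intro s r hr n
    obtain ⟨k, hk, h0⟩ := mem_Phi_iff.1 hr n
    -- The even half of the input is the program and the odd half its argument: the bound covers the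
    -- first `i` argument entries and the program entry consulted at stage `i`, for every `i ≤ k`.
    obtain ⟨K, hK⟩ := exists_bound
      (fun i => 2 * i + (2 * Encodable.encode (n, initSeg (sndB s) i) + 1)) k
    have key : ∀ i ≤ k, (if 2 * i ≤ (initSeg s K).length then
        (initSeg s K)[2 * Encodable.encode (n, oddPart (initSeg s K) i)]? else none) =
        some (look (fstB s) (sndB s) n i) := by
      intro i hi
      have := hK i hi
      rw [length_initSeg, if_pos (by omega), oddPart_initSeg s (by omega), initSeg_getElem?,
        if_pos (by omega)]
      rfl
    refine ⟨k, K, fun i hi => ?_, ?_⟩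
    · exact (key i hi.le).trans (by rw [h0 i hi])
    · exact (key k le_rfl).trans (by rw [hk])

/-! ### Composition and other closure properties -/

/-- The part of the output that is determined by the approximation `A` on `w` in `m` steps. -/
def outputs (A : ℕ → List ℕ → Option ℕ) (w : List ℕ) : ℕ → List ℕ
  | 0 => []
  | m + 1 => (A (outputs A w m).length w).elim (outputs A w m) fun v => outputs A w m ++ [v]

theorem length_outputs_le (A : ℕ → List ℕ → Option ℕ) (w : List ℕ) (m : ℕ) :
    (outputs A w m).length ≤ m := by
  induction m with
  | zero => simp [outputs]
  | succ m ih =>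
    rw [outputs]
    cases A (outputs A w m).length w <;> simp <;> omega

theorem outputs_spec (A : ℕ → List ℕ → Option ℕ) (w : List ℕ) (m i v : ℕ)
    (h : (outputs A w m)[i]? = some v) : A i w = some v := by
  induction m with
  | zero => simp [outputs] at h
  | succ m ih =>
    rw [outputs] at h
    cases e : A (outputs A w m).length w with
    | none => rw [e] at h; exact ih h
    | some u =>
      rw [e] at h
      simp only [Option.elim, List.getElem?_append] at h
      split_ifs at h with hi
      · exact ih h
      · have : i - (outputs A w m).length = 0 := by
          by_contra hne
          rw [List.getElem?_eq_none (by simp; omega)] at h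
          cases h
        rw [this] at h
        have hi' : i = (outputs A w m).length := by omega
        rw [hi', e]
        simpa using h

/-- Each round adds one symbol as long as `A` has an answer, so any list confirmed by `A` is
reproduced as far as the number of rounds permits. Both monotonicity of `outputs` and its
convergence follow from this. -/
theorem take_prefix_outputs {A : ℕ → List ℕ → Option ℕ} {w u : List ℕ}
    (h : ∀ i v, u[i]? = some v → A i w = some v) (m : ℕ) : u.take m <+: outputs A w m := by
  induction m with
  | zero => simp
  | succ m ih =>
    rw [outputs]
    by_cases hm : m < u.length
    · have hs : outputs A w m = u.take m :=
        (ih.eq_of_length_le (by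
          rw [List.length_take, min_eq_left hm.le]; exact length_outputs_le A w m)).symm
      have hl : (u.take m).length = m := by simp [hm.le]
      rw [hs, hl, h m u[m] (List.getElem?_eq_getElem hm)]
      simp
    · have e : u.take (m + 1) = u.take m := by
        rw [List.take_of_length_le (by omega), List.take_of_length_le (by omega)]
      rw [e]
      refine ih.trans ?_
      cases A (outputs A w m).length w <;> simp

theorem Approx.outputs_mono {A F} (h : Approx A F) {w w' : List ℕ} (hw : w <+: w') {m m' : ℕ}
    (hm : m ≤ m') : outputs A w m <+: outputs A w' m' := by
  have := take_prefix_outputs (A := A) (w := w') (u := outputs A w m)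
    (fun i v hv => h.mono hw (outputs_spec A w m i v hv)) m'
  rwa [List.take_of_length_le ((length_outputs_le A w m).trans hm)] at this

theorem Approx.bind {A B F G} (hF : Approx A F) (hG : Approx B G) :
    Approx (fun n w => B n (outputs A w w.length)) (fun q => (F q).bind G) where
  comp := by
    have hs : Computable fun w : List ℕ => outputs A w w.length := by
      have hrec := Computable.nat_rec (α := List ℕ) (σ := List ℕ)
        (f := fun w => w.length) (g := fun _ => [])
        (h := fun w y => ((A y.2.length w).map fun v => y.2 ++ [v]).getD y.2)
        Computable.list_length (Computable.const _) ?_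
      · refine hrec.of_eq fun w => ?_
        generalize w.length = m
        induction m with
        | zero => rfl
        | succ m ih =>
          simp only [outputs, ← ih]
          cases A _ w <;> rfl
      · refine Computable.option_getD (Computable.option_map (hF.comp.comp
          (Computable.list_length.comp (Computable.snd.comp Computable.snd)) Computable.fst) ?_)
          (Computable.snd.comp Computable.snd)
        exact Computable.list_concat.comp (Computable.snd.comp (Computable.snd.comp Computable.fst))
          Computable.snd
    exact hG.comp.comp Computable.fst (hs.comp Computable.snd)
  mono := fun hw h => hG.mono (hF.outputs_mono hw hw.length_le) h
  conv := by
    intro q r hr n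
    obtain ⟨a, ha, hr⟩ := Part.mem_bind_iff.1 hr
    obtain ⟨k, hk⟩ := hG.conv hr n
    -- `B` reads only the first `k` symbols of the intermediate result, so a common bound for the
    -- input lengths that fix those symbols suffices.
    choose f hf using fun i => hF.eventually ha i
    obtain ⟨K, hK⟩ := exists_bound f k
    refine ⟨max K k, hG.mono ?_ hk⟩
    rw [length_initSeg]
    have := take_prefix_outputs (A := A) (w := initSeg q (max K k)) (u := initSeg a k)
      (fun i v hv => by
        rw [initSeg_getElem?] at hv
        split_ifs at hv with hi
        rw [← hv]
        exact hf i _ ((hK i hi.le).trans (le_max_left _ _))) (max K k)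
    rwa [List.take_of_length_le (by rw [length_initSeg]; exact le_max_right _ _)] at this

theorem IsComputable.bind {F G : Baire →. Baire} (hF : IsComputable F) (hG : IsComputable G) :
    IsComputable fun q => (F q).bind G := by
  obtain ⟨A, hA⟩ := hF.exists_approx
  obtain ⟨B, hB⟩ := hG.exists_approx
  exact (hA.bind hB).isComputable

/-- A computable function need only be extended by a machine, so restricting its domain costs
nothing. -/
theorem IsComputable.mono {F G : Baire →. Baire} (hF : IsComputable F)
    (h : ∀ q r, r ∈ G q → r ∈ F q) : IsComputable G := by
  obtain ⟨p, hp, hq⟩ := hF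
  exact ⟨p, hp, fun q r hr => hq q r (h q r hr)⟩

theorem IsComputable.pair {F G : Baire →. Baire} (hF : IsComputable F) (hG : IsComputable G) :
    IsComputable fun q => (F q).bind fun a => (G q).map fun b => pair a b := by
  obtain ⟨A, hA⟩ := hF.exists_approx
  obtain ⟨B, hB⟩ := hG.exists_approx
  refine Approx.isComputable
    (A := fun n w => if n % 2 = 0 then A (n / 2) w else B (n / 2) w) ⟨?_, ?_, ?_⟩
  · have h2 : Computable fun x : ℕ × List ℕ => x.1 / 2 :=
      (Primrec.nat_div.comp Primrec.fst (Primrec.const 2)).to_comp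
    exact computable_ite (c := fun x : ℕ × List ℕ => x.1 % 2 = 0) (primrec_even.comp Primrec.fst)
      (hA.comp.comp h2 Computable.snd) (hB.comp.comp h2 Computable.snd)
  · intro n w w' v hw h
    split_ifs at h ⊢
    exacts [hA.mono hw h, hB.mono hw h]
  · intro q r hr n
    obtain ⟨a, ha, hr⟩ := Part.mem_bind_iff.1 hr
    obtain ⟨b, hb, rfl⟩ := (Part.mem_map_iff _).1 hr
    simp only [Weihrauch.pair]
    split_ifs
    exacts [hA.conv ha _, hB.conv hb _]

theorem IsComputable.ite {F G : Baire →. Baire} (hF : IsComputable F) (hG : IsComputable G) :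
    IsComputable fun q => if q 0 = 0 then F q else G q := by
  obtain ⟨A, hA⟩ := hF.exists_approx
  obtain ⟨B, hB⟩ := hG.exists_approx
  refine Approx.isComputable
    (A := fun n w => w[0]?.bind fun d => if d = 0 then A n w else B n w) ⟨?_, ?_, ?_⟩
  · refine Computable.option_bind (Computable.list_getElem?.comp Computable.snd
      (Computable.const 0)) ?_
    exact computable_ite (c := fun x : (ℕ × List ℕ) × ℕ => x.2 = 0)
      (Primrec.eq.comp Primrec.snd (Primrec.const 0)) (hA.comp.comp
        (Computable.fst.comp Computable.fst) (Computable.snd.comp Computable.fst))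
      (hB.comp.comp (Computable.fst.comp Computable.fst) (Computable.snd.comp Computable.fst))
  · intro n w w' v hw h
    rw [Option.bind_eq_some_iff] at h ⊢
    obtain ⟨d, hd, h⟩ := h
    refine ⟨d, getElem?_of_prefix hw hd, ?_⟩
    split_ifs at h ⊢
    exacts [hA.mono hw h, hB.mono hw h]
  · intro q r hr n
    have key : ∀ {C H}, Approx C H → r ∈ H q → ∃ k, 0 < k ∧ C n (initSeg q k) = some (r n) := by
      intro C H hC hr
      obtain ⟨k, hk⟩ := hC.eventually hr n
      exact ⟨k + 1, k.succ_pos, hk _ k.le_succ⟩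
    by_cases h0 : q 0 = 0
    · rw [if_pos h0] at hr
      obtain ⟨k, hk, h⟩ := key hA hr
      exact ⟨k, by simp [initSeg_getElem?, hk, h0, h]⟩
    · rw [if_neg h0] at hr
      obtain ⟨k, hk, h⟩ := key hB hr
      exact ⟨k, by simp [initSeg_getElem?, hk, h0, h]⟩

/-- Functions each of whose output entries depends on one input entry only. -/
theorem isComputable_local {g : ℕ → ℕ → ℕ} {b : ℕ → ℕ} (hg : Computable₂ g)
    (hb : Computable b) : IsComputable fun q => Part.some fun n => g n (q (b n)) := by
  refine Approx.isComputable (A := fun n w => w[b n]?.map (g n)) ⟨?_, ?_, ?_⟩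
  · exact Computable.option_map (Computable.list_getElem?.comp Computable.snd
      (hb.comp Computable.fst)) (hg.comp (Computable.fst.comp Computable.fst) Computable.snd)
  · intro n w w' v hw h
    rw [Option.map_eq_some_iff] at h ⊢
    obtain ⟨d, hd, h⟩ := h
    exact ⟨d, getElem?_of_prefix hw hd, h⟩
  · intro q r hr n
    rw [Part.mem_some_iff.1 hr]
    exact ⟨b n + 1, by simp [initSeg_getElem?]⟩

/-! ### Currying of programs -/

/-- Interleaving of the first `v.length` entries of `w` with `v`. -/
def interleave (w v : List ℕ) : List ℕ :=
  (List.range (2 * v.length)).map fun i =>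
    if i % 2 = 0 then w.getD (i / 2) 0 else v.getD (i / 2) 0

theorem interleave_initSeg (q r : Baire) {k l : ℕ} (h : k ≤ l) :
    interleave (initSeg q l) (initSeg r k) = initSeg (pair q r) (2 * k) := by
  rw [interleave, length_initSeg]
  change _ = (List.range (2 * k)).map (pair q r)
  refine List.map_congr_left fun i hi => ?_
  rw [List.mem_range] at hi
  simp only [List.getD_eq_getElem?_getD, initSeg_getElem?, pair]
  split_ifs <;> first | rfl | omega

theorem interleave_of_prefix {w w' v : List ℕ} (h : w <+: w') (hv : v.length ≤ w.length) :
    interleave w' v = interleave w v := by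
  refine List.map_congr_left fun i hi => ?_
  rw [List.mem_range] at hi
  obtain ⟨u, rfl⟩ := h
  rw [List.getD_append _ _ _ _ (by omega)]

theorem primrec_interleave : Primrec₂ interleave := by
  refine Primrec.list_map (Primrec.list_range.comp (Primrec.nat_mul.comp (Primrec.const 2)
    (Primrec.list_length.comp Primrec.snd))) ?_
  have h2 : Primrec fun x : (List ℕ × List ℕ) × ℕ => x.2 / 2 :=
    Primrec.nat_div.comp Primrec.snd (Primrec.const 2)
  exact Primrec.ite (primrec_even.comp Primrec.snd)
    ((Primrec.list_getD 0).comp (Primrec.fst.comp Primrec.fst) h2)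
    ((Primrec.list_getD 0).comp (Primrec.snd.comp Primrec.fst) h2)

/-- A total computable map on Baire space. -/
def ComputableMap (F : Baire → Baire) : Prop := IsComputable fun q => Part.some (F q)

/-- The smn theorem. -/
theorem IsComputable.exists_curry {F : Baire →. Baire} (hF : IsComputable F) :
    ∃ S : Baire → Baire, ComputableMap S ∧
      ∀ q r t, t ∈ F (Weihrauch.pair q r) → t ∈ Phi (S q) r := by
  obtain ⟨A, hA⟩ := hF.exists_approx
  let d := Denumerable.ofNat (ℕ × List ℕ)
  have hd : Computable d := Computable.ofNat _
  have hd' : Primrec d := Primrec.ofNat _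
  -- The entry of the curried program for an argument segment `w` uses only the first `length w`
  -- entries of `q`. Therefore the map to programs is total and continuous even where `F` is
  -- undefined.
  refine ⟨fun q m => entry (A (d m).1 (interleave (initSeg q (d m).2.length) (d m).2)), ?_, ?_⟩
  · refine Approx.isComputable (A := fun m w => if (d m).2.length ≤ w.length then
      some (entry (A (d m).1 (interleave w (d m).2))) else none) ⟨?_, ?_, ?_⟩
    · refine computable_ite (c := fun x : ℕ × List ℕ => (d x.1).2.length ≤ x.2.length)
        (Primrec.nat_le.comp (Primrec.list_length.comp (Primrec.snd.comp (hd'.comp Primrec.fst)))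
          (Primrec.list_length.comp Primrec.snd))
        (Computable.option_some.comp (computable_entry.comp (hA.comp.comp
          (Computable.fst.comp (hd.comp Computable.fst)) ?_))) (Computable.const _)
      exact (primrec_interleave.comp Primrec.snd
        (Primrec.snd.comp (hd'.comp Primrec.fst))).to_comp
    · intro m w w' v hw h
      split_ifs at h with hl
      rw [if_pos (hl.trans hw.length_le), interleave_of_prefix hw hl]
      exact h
    · intro q r hr m
      rw [Part.mem_some_iff.1 hr]
      exact ⟨(d m).2.length, by rw [length_initSeg, if_pos le_rfl]⟩
  · intro q r t ht
    have key : ∀ n k, look (fun m => entry (A (d m).1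
        (interleave (initSeg q (d m).2.length) (d m).2))) r n k =
        entry (A n (initSeg (Weihrauch.pair q r) (2 * k))) := by
      intro n k
      rw [look_eq]
      simp only [d, Denumerable.ofNat_encode, length_initSeg]
      rw [interleave_initSeg q r le_rfl]
    refine mem_Phi_of (fun n k => ?_) fun n => ?_
    · rw [key]
      cases e : A n (initSeg (Weihrauch.pair q r) (2 * k)) with
      | none => exact Or.inl rfl
      | some v => exact Or.inr (by rw [hA.consistent ht e]; rfl)
    · obtain ⟨k, hk⟩ := hA.eventually ht n
      exact ⟨k, by rw [key, hk _ (by omega)]; exact Nat.succ_ne_zero _⟩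

/-! ## Total computable maps -/

theorem pair_fstB_sndB (r : Baire) : pair (fstB r) (sndB r) = r := by
  funext n
  rcases Nat.mod_two_eq_zero_or_one n with h | h
  · simp only [pair, h, if_true, fstB]
    congr 1; omega
  · simp only [pair, h, one_ne_zero, if_false, sndB]
    congr 1; omega

/-- The sequence with the first entry of `q`, followed by `r`. -/
def withHead (q r : Baire) : Baire := fun n => Nat.casesOn n (q 0) r

@[simp] theorem withHead_zero (q r : Baire) : withHead q r 0 = q 0 := rfl

@[simp] theorem tailB_withHead (q r : Baire) : tailB (withHead q r) = r := rfl

theorem IsComputable.comp_map {F : Baire → Baire} {G : Baire →. Baire} (hG : IsComputable G)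
    (hF : ComputableMap F) : IsComputable fun q => G (F q) :=
  (IsComputable.bind hF hG).mono fun _ _ hr => Part.mem_bind (Part.mem_some _) hr

namespace ComputableMap

theorem comp {F G : Baire → Baire} (hG : ComputableMap G) (hF : ComputableMap F) :
    ComputableMap fun q => G (F q) :=
  IsComputable.comp_map (G := fun q => Part.some (G q)) hG hF

theorem select {b : ℕ → ℕ} (hb : Computable b) : ComputableMap fun q n => q (b n) :=
  isComputable_local (g := fun _ x => x) Computable.snd hb

protected theorem id : ComputableMap fun q => q := select Computable.id

theorem const {p : Baire} (hp : Computable p) : ComputableMap fun _ => p :=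
  isComputable_local (g := fun n _ => p n) (hp.comp Computable.fst) Computable.id

theorem pair {F G : Baire → Baire} (hF : ComputableMap F) (hG : ComputableMap G) :
    ComputableMap fun q => pair (F q) (G q) :=
  (IsComputable.pair hF hG).mono fun q r hr => by simpa using hr

theorem fst {F : Baire → Baire} (hF : ComputableMap F) : ComputableMap fun q => fstB (F q) :=
  comp (G := fstB) (select (Primrec.nat_mul.comp (Primrec.const 2) Primrec.id).to_comp) hF

theorem snd {F : Baire → Baire} (hF : ComputableMap F) : ComputableMap fun q => sndB (F q) :=
  comp (G := sndB)
    (select (Primrec.succ.comp (Primrec.nat_mul.comp (Primrec.const 2) Primrec.id)).to_comp) hF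

theorem tail {F : Baire → Baire} (hF : ComputableMap F) : ComputableMap fun q => tailB (F q) :=
  comp (G := tailB) (select Computable.succ) hF

theorem withHead {F G : Baire → Baire} (hF : ComputableMap F) (hG : ComputableMap G) :
    ComputableMap fun q => withHead (F q) (G q) := by
  have h : ComputableMap fun q => Weihrauch.withHead (fstB q) (sndB q) := by
    have hb : Computable fun n : ℕ => if n = 0 then 0 else 2 * n.pred + 1 :=
      (Primrec.ite (Primrec.eq.comp Primrec.id (Primrec.const 0)) (Primrec.const 0)
        (Primrec.succ.comp (Primrec.nat_mul.comp (Primrec.const 2) Primrec.pred))).to_comp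
    refine (select hb).mono fun q r hr => ?_
    rw [Part.mem_some_iff.1 hr, Part.mem_some_iff]
    funext n
    cases n <;> rfl
  have := h.comp (hF.pair hG)
  simpa only [fstB_pair, sndB_pair] using this

theorem ite {F G H : Baire → Baire} (hH : ComputableMap H) (hF : ComputableMap F)
    (hG : ComputableMap G) : ComputableMap fun q => if H q 0 = 0 then F q else G q := by
  have h1 := (IsComputable.ite
    (ComputableMap.comp hF (snd ComputableMap.id)) (ComputableMap.comp hG (snd ComputableMap.id)))
  refine (h1.comp_map ((hH.pair ComputableMap.id))).mono fun q r hr => ?_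
  change r ∈ if H q 0 = 0 then Part.some (F (sndB (Weihrauch.pair (H q) q)))
    else Part.some (G (sndB (Weihrauch.pair (H q) q)))
  rw [sndB_pair, Part.mem_some_iff.1 hr]
  beta_reduce
  split_ifs <;> exact Part.mem_some _

theorem phi {F G : Baire → Baire} (hF : ComputableMap F) (hG : ComputableMap G) :
    IsComputable fun q => Phi (F q) (G q) := by
  have := isComputable_universal.comp_map (hF.pair hG)
  simpa only [fstB_pair, sndB_pair] using this

end ComputableMap

theorem IsComputable.bind_pair {F G : Baire →. Baire} (hF : IsComputable F)
    (hG : IsComputable G) : IsComputable fun q => (F q).bind fun r => G (Weihrauch.pair q r) :=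
  ((IsComputable.pair ComputableMap.id hF).bind hG).mono fun q r hr => by
    obtain ⟨a, ha, h⟩ := Part.mem_bind_iff.1 hr
    exact Part.mem_bind (Part.mem_bind (Part.mem_some _) (Part.mem_map _ ha)) h

theorem IsComputable.map_pair {F : Baire →. Baire} {G : Baire → Baire} (hF : IsComputable F)
    (hG : ComputableMap G) : IsComputable fun q => (F q).map fun r => G (Weihrauch.pair q r) :=
  (hF.bind_pair hG).mono fun q r hr => by rwa [Part.bind_some_eq_map]

/-! ## Multi-valued functions on names -/

/-- The relation between names induced by a multi-valued function. -/
def names {X Y : RepSpace} (f : MultiFun X Y) (p : Baire) : Set Baire :=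
  {q | ∃ x ∈ X.δ p, ∃ y ∈ Y.δ q, y ∈ f x}

/-- Weihrauch reducibility for multi-valued functions on Baire space. -/
def NameReducible (f g : Baire → Set Baire) : Prop :=
  ∃ k h : Baire, Computable k ∧ Computable h ∧ ∀ p, (f p).Nonempty →
    ∃ a ∈ Phi h p, (g a).Nonempty ∧ ∀ b ∈ g a, ∃ q ∈ Phi k (pair p b), q ∈ f p

theorem names_nonempty {X Y : RepSpace} {f : MultiFun X Y} {p : Baire} :
    (names f p).Nonempty ↔ ∃ x ∈ X.δ p, x ∈ f.dom := by
  constructor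
  · rintro ⟨q, x, hx, y, -, hy⟩
    exact ⟨x, hx, y, hy⟩
  · rintro ⟨x, hx, y, hy⟩
    obtain ⟨q, hq⟩ := Y.surj y
    exact ⟨q, x, hx, y, hq, hy⟩

theorem mem_names {X Y : RepSpace} {f : MultiFun X Y} {p q : Baire} {x : X.carrier}
    (hx : x ∈ X.δ p) : q ∈ names f p ↔ ∃ y ∈ Y.δ q, y ∈ f x := by
  constructor
  · rintro ⟨x', hx', h⟩
    rwa [Part.mem_unique hx hx']
  · exact fun h => ⟨x, hx, h⟩

theorem dom_nonempty_iff {X Y : RepSpace} {f : MultiFun X Y} :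
    f.dom.Nonempty ↔ ∃ p, (names f p).Nonempty := by
  simp only [names_nonempty]
  constructor
  · rintro ⟨x, hx⟩
    obtain ⟨p, hp⟩ := X.surj x
    exact ⟨p, x, hp, hx⟩
  · rintro ⟨p, x, -, hx⟩
    exact ⟨x, hx⟩

theorem realizes_iff {X Y : RepSpace} {G : Baire →. Baire} {f : MultiFun X Y} :
    Realizes G f ↔ ∀ p, (names f p).Nonempty → ∃ q ∈ G p, q ∈ names f p := by
  constructor
  · intro h p hp
    obtain ⟨x, hx, hd⟩ := names_nonempty.1 hp
    obtain ⟨q, hq, hy⟩ := h p x hx hd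
    exact ⟨q, hq, x, hx, hy⟩
  · intro h p x hx hd
    obtain ⟨q, hq, hn⟩ := h p (names_nonempty.2 ⟨x, hx, hd⟩)
    exact ⟨q, hq, (mem_names hx).1 hn⟩

/-- A reduction makes one query, chosen before the realizer answers. Quantifying over all realizers
is thus the same as quantifying over all solutions of that query. -/
theorem reducible_iff {X Y U V : RepSpace} {f : MultiFun X Y} {g : MultiFun U V} :
    Reducible f g ↔ NameReducible (names f) (names g) := by
  classical
  constructor
  · rintro ⟨K, H, ⟨k, hk, hK⟩, ⟨h, hh, hH⟩, hG⟩
    refine ⟨k, h, hk, hh, fun p hp => ?_⟩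
    -- The realizer is made undefined outside the domain of `names g`, so its success proves that
    -- the query is a solvable instance.
    have hsol : ∀ G : Baire → Baire, (∀ a, (names g a).Nonempty → G a ∈ names g a) →
        ∃ a ∈ H p, (names g a).Nonempty ∧ ∃ q ∈ K (pair p (G a)), q ∈ names f p := by
      intro G hGr
      obtain ⟨q, hq, hqn⟩ := realizes_iff.1 (hG (fun a => ⟨(names g a).Nonempty, fun _ => G a⟩)
        (realizes_iff.2 fun a ha => ⟨G a, ⟨ha, rfl⟩, hGr a ha⟩)) p hp
      obtain ⟨a, ha, hq⟩ := Part.mem_bind_iff.1 hq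
      obtain ⟨b, ⟨hb, rfl⟩, hq⟩ := Part.mem_bind_iff.1 hq
      exact ⟨a, ha, hb, q, hq, hqn⟩
    let G₀ : Baire → Baire := fun a => if ha : (names g a).Nonempty then ha.some else a
    have hG₀ : ∀ a, (names g a).Nonempty → G₀ a ∈ names g a := fun a ha => by
      simp only [G₀, dif_pos ha]; exact ha.some_mem
    obtain ⟨a, ha, hga, -⟩ := hsol G₀ hG₀
    refine ⟨a, hH _ _ ha, hga, fun b hb => ?_⟩
    -- Changing the realizer at `a` alone forces `b` as the answer; the query stays `a`, because it
    -- does not depend on the realizer.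
    obtain ⟨a', ha', -, q, hq, hqn⟩ := hsol (Function.update G₀ a b) fun c hc => by
      by_cases hca : c = a
      · subst hca; simpa using hb
      · simpa [hca] using hG₀ c hc
    obtain rfl := Part.mem_unique ha ha'
    rw [Function.update_self] at hq
    exact ⟨q, hK _ _ hq, hqn⟩
  · rintro ⟨k, h, hk, hh, hr⟩
    refine ⟨Phi k, Phi h, ⟨k, hk, fun _ _ => id⟩, ⟨h, hh, fun _ _ => id⟩, fun G hG => ?_⟩
    refine realizes_iff.2 fun p hp => ?_
    obtain ⟨a, ha, hga, hb⟩ := hr p hp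
    obtain ⟨b, hbG, hbn⟩ := realizes_iff.1 hG a hga
    obtain ⟨q, hq, hqn⟩ := hb b hbn
    exact ⟨q, Part.mem_bind ha (Part.mem_bind hbG hq), hqn⟩

/-- Reductions with a total inner map. -/
theorem NameReducible.mk {f g : Baire → Set Baire} {K : Baire →. Baire} {H : Baire → Baire}
    (hK : IsComputable K) (hH : ComputableMap H) (h : ∀ p, (f p).Nonempty →
      (g (H p)).Nonempty ∧ ∀ b ∈ g (H p), ∃ q ∈ K (pair p b), q ∈ f p) : NameReducible f g := by
  obtain ⟨k, hk, hkK⟩ := hK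
  obtain ⟨e, he, heH⟩ := hH
  refine ⟨k, e, hk, he, fun p hp => ⟨H p, heH _ _ (Part.mem_some _), (h p hp).1, fun b hb => ?_⟩⟩
  obtain ⟨q, hq, hqf⟩ := (h p hp).2 b hb
  exact ⟨q, hkK _ _ hq, hqf⟩

/-- Reductions with total maps. -/
theorem NameReducible.mk_total {f g : Baire → Set Baire} {K H : Baire → Baire}
    (hK : ComputableMap K) (hH : ComputableMap H) (h : ∀ p, (f p).Nonempty →
      (g (H p)).Nonempty ∧ ∀ b ∈ g (H p), K (pair p b) ∈ f p) : NameReducible f g :=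
  .mk hK hH fun p hp => ⟨(h p hp).1, fun b hb => ⟨_, Part.mem_some _, (h p hp).2 b hb⟩⟩

theorem NameReducible.of_empty {f g : Baire → Set Baire} (h : ∀ p, ¬ (f p).Nonempty) :
    NameReducible f g :=
  .mk_total ComputableMap.id ComputableMap.id fun p hp => (h p hp).elim

theorem NameReducible.refl (f : Baire → Set Baire) : NameReducible f f :=
  .mk_total (ComputableMap.id.snd) ComputableMap.id fun p hp =>
    ⟨hp, fun b hb => by rwa [sndB_pair]⟩

/-- The product on names. -/
def nameProd (f g : Baire → Set Baire) (p : Baire) : Set Baire :=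
  {q | fstB q ∈ f (fstB p) ∧ sndB q ∈ g (sndB p)}

/-- The coproduct on names. -/
def nameCoprod (f g : Baire → Set Baire) (p : Baire) : Set Baire :=
  {q | (p 0 = 0 ∧ q 0 = 0 ∧ tailB q ∈ f (tailB p)) ∨ (p 0 = 1 ∧ q 0 = 1 ∧ tailB q ∈ g (tailB p))}

/-- The meet on names. -/
def nameMeet (f g : Baire → Set Baire) (p : Baire) : Set Baire :=
  {q | (f (fstB p)).Nonempty ∧ (g (sndB p)).Nonempty ∧
    ((q 0 = 0 ∧ tailB q ∈ f (fstB p)) ∨ (q 0 = 1 ∧ tailB q ∈ g (sndB p)))}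

/-- The compositional product on names. -/
def nameStar (f g : Baire → Set Baire) (p : Baire) : Set Baire :=
  {q | (∀ y ∈ g (sndB p), ∀ j, ∃ r ∈ Phi (fstB p) (pair y j), (f (sndB r)).Nonempty) ∧
    ∃ y ∈ g (sndB p), ∃ j, ∃ r ∈ Phi (fstB p) (pair y j), fstB q = fstB r ∧ sndB q ∈ f (sndB r)}

/-- The implication on names. -/
def nameImpl (g f : Baire → Set Baire) (u : Baire) : Set Baire :=
  {q | (g (sndB q)).Nonempty ∧ ∀ y ∈ g (sndB q), ∀ j, ∃ r ∈ Phi (fstB q) (pair y j), r ∈ f u}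

/-! ### The operations on degrees, computed on names -/

theorem mem_prodSpace {X Y : RepSpace} {r : Baire} {a : (prodSpace X Y).carrier} :
    a ∈ (prodSpace X Y).δ r ↔ a.1 ∈ X.δ (fstB r) ∧ a.2 ∈ Y.δ (sndB r) := by
  obtain ⟨x, y⟩ := a
  constructor
  · intro h
    obtain ⟨x', hx, h⟩ := Part.mem_bind_iff.1 h
    obtain ⟨y', hy, h⟩ := (Part.mem_map_iff _).1 h
    cases h
    exact ⟨hx, hy⟩
  · rintro ⟨hx, hy⟩
    exact Part.mem_bind hx (Part.mem_map _ hy)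

theorem inl_mem_sumSpace {X Y : RepSpace} {r : Baire} {x : X.carrier} :
    (Sum.inl x : (sumSpace X Y).carrier) ∈ (sumSpace X Y).δ r ↔ r 0 = 0 ∧ x ∈ X.δ (tailB r) := by
  have h : (Sum.inl x : (sumSpace X Y).carrier) ∈ (sumSpace X Y).δ r ↔
      Sum.inl x ∈ if r 0 = 0 then (X.δ (tailB r)).map Sum.inl
        else if r 0 = 1 then (Y.δ (tailB r)).map Sum.inr else Part.none := Iff.rfl
  refine h.trans ?_
  split_ifs with h0 h1
  · exact (Part.mem_map_iff _).trans (by simp [h0])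
  · exact (Part.mem_map_iff _).trans (by simp [h0])
  · simp [h0]

theorem inr_mem_sumSpace {X Y : RepSpace} {r : Baire} {y : Y.carrier} :
    (Sum.inr y : (sumSpace X Y).carrier) ∈ (sumSpace X Y).δ r ↔ r 0 = 1 ∧ y ∈ Y.δ (tailB r) := by
  have h : (Sum.inr y : (sumSpace X Y).carrier) ∈ (sumSpace X Y).δ r ↔
      Sum.inr y ∈ if r 0 = 0 then (X.δ (tailB r)).map Sum.inl
        else if r 0 = 1 then (Y.δ (tailB r)).map Sum.inr else Part.none := Iff.rfl
  refine h.trans ?_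
  split_ifs with h0 h1
  · exact (Part.mem_map_iff _).trans (by simp [h0])
  · exact (Part.mem_map_iff _).trans (by simp [h1])
  · simp [h1]

theorem names_prod {X Y U V : RepSpace} (f : MultiFun X Y) (g : MultiFun U V) :
    names (f.prod g) = nameProd (names f) (names g) := by
  funext p
  ext q
  constructor
  · rintro ⟨a, ha, b, hb, h⟩
    replace ha := mem_prodSpace.1 ha
    replace hb := mem_prodSpace.1 hb
    exact ⟨⟨_, ha.1, _, hb.1, h.1⟩, ⟨_, ha.2, _, hb.2, h.2⟩⟩
  · rintro ⟨⟨x, hx, y, hy, h⟩, ⟨u, hu, v, hv, h'⟩⟩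
    exact ⟨(x, u), mem_prodSpace.2 ⟨hx, hu⟩, (y, v), mem_prodSpace.2 ⟨hy, hv⟩, h, h'⟩

theorem names_coprod {X Y U V : RepSpace} (f : MultiFun X Y) (g : MultiFun U V) :
    names (f.coprod g) = nameCoprod (names f) (names g) := by
  funext p
  ext q
  constructor
  · rintro ⟨x | u, ha, b, hb, h⟩
    · obtain ⟨y, hy, rfl⟩ := h
      replace ha := inl_mem_sumSpace.1 ha
      replace hb := inl_mem_sumSpace.1 hb
      exact Or.inl ⟨ha.1, hb.1, x, ha.2, y, hb.2, hy⟩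
    · obtain ⟨y, hy, rfl⟩ := h
      replace ha := inr_mem_sumSpace.1 ha
      replace hb := inr_mem_sumSpace.1 hb
      exact Or.inr ⟨ha.1, hb.1, u, ha.2, y, hb.2, hy⟩
  · rintro (⟨hp, hq, x, hx, y, hy, h⟩ | ⟨hp, hq, x, hx, y, hy, h⟩)
    · exact ⟨Sum.inl x, inl_mem_sumSpace.2 ⟨hp, hx⟩, Sum.inl y, inl_mem_sumSpace.2 ⟨hq, hy⟩,
        y, h, rfl⟩
    · exact ⟨Sum.inr x, inr_mem_sumSpace.2 ⟨hp, hx⟩, Sum.inr y, inr_mem_sumSpace.2 ⟨hq, hy⟩,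
        y, h, rfl⟩

theorem names_meet {X Y U V : RepSpace} (f : MultiFun X Y) (g : MultiFun U V) :
    names (f.meet g) = nameMeet (names f) (names g) := by
  funext p
  ext q
  constructor
  · rintro ⟨a, ha, b, hb, hf, hg, h⟩
    replace ha := mem_prodSpace.1 ha
    refine ⟨names_nonempty.2 ⟨_, ha.1, hf⟩, names_nonempty.2 ⟨_, ha.2, hg⟩, ?_⟩
    rcases h with ⟨y, hy, rfl⟩ | ⟨y, hy, rfl⟩
    · replace hb := inl_mem_sumSpace.1 hb
      exact Or.inl ⟨hb.1, _, ha.1, y, hb.2, hy⟩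
    · replace hb := inr_mem_sumSpace.1 hb
      exact Or.inr ⟨hb.1, _, ha.2, y, hb.2, hy⟩
  · rintro ⟨hf, hg, h⟩
    obtain ⟨x, hx, hxf⟩ := names_nonempty.1 hf
    obtain ⟨u, hu, hug⟩ := names_nonempty.1 hg
    refine ⟨(x, u), mem_prodSpace.2 ⟨hx, hu⟩, ?_⟩
    rcases h with ⟨hq, h⟩ | ⟨hq, h⟩
    · obtain ⟨y, hy, h⟩ := (mem_names hx).1 h
      exact ⟨Sum.inl y, inl_mem_sumSpace.2 ⟨hq, hy⟩, hxf, hug, Or.inl ⟨y, h, rfl⟩⟩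
    · obtain ⟨y, hy, h⟩ := (mem_names hu).1 h
      exact ⟨Sum.inr y, inr_mem_sumSpace.2 ⟨hq, hy⟩, hxf, hug, Or.inr ⟨y, h, rfl⟩⟩

theorem pair_mem_cylNames {X : RepSpace} {x : X.carrier} {y j : Baire} (h : x ∈ X.δ y) :
    pair y j ∈ cylNames X x := by
  change x ∈ X.δ (fstB (pair y j))
  rwa [fstB_pair]

theorem PhiMulti_dom {Y Z : RepSpace} {e : Baire} {y : Y.carrier} :
    y ∈ (PhiMulti Y Z e).dom ↔ ∀ q ∈ cylNames Y y, ∃ r ∈ Phi e q, (Z.δ r).Dom := by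
  constructor
  · rintro ⟨z, h, -⟩
    exact h
  · intro h
    obtain ⟨p, hp⟩ := Y.surj y
    have hq := pair_mem_cylNames (j := p) hp
    obtain ⟨r, hr, hd⟩ := h _ hq
    exact ⟨(Z.δ r).get hd, h, _, hq, r, hr, Part.get_mem hd⟩

theorem mem_PhiMulti {Y Z : RepSpace} {e : Baire} {y : Y.carrier} {z : Z.carrier} :
    z ∈ PhiMulti Y Z e y ↔ y ∈ (PhiMulti Y Z e).dom ∧
      ∃ q ∈ cylNames Y y, ∃ r ∈ Phi e q, z ∈ Z.δ r := by
  rw [PhiMulti_dom]; rfl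

theorem mem_funSpace {Y Z : RepSpace} {e : Baire} {h : (funSpace Y Z).carrier} :
    h ∈ (funSpace Y Z).δ e ↔ h = ⟨PhiMulti Y Z e, e, rfl⟩ := Part.mem_some_iff

/-- Composition is demonic: every solution of `g`, under every cylindrical name, must be mapped to a
solution. Hence the auxiliary entry `j` in `nameImpl` is universally quantified. The assumption `hu`
supplies the point named by `u`. -/
theorem names_impl_of_nonempty {X Y U V : RepSpace} (g : MultiFun X Y) (f : MultiFun U V) (u : Baire)
    (hu : (names f u).Nonempty) : names (g.impl f) u = nameImpl (names g) (names f) u := by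
  obtain ⟨x, hx, -⟩ := names_nonempty.1 hu
  ext q
  rw [mem_names hx]
  constructor
  · rintro ⟨⟨h, a⟩, ha, ⟨v, hdom, y, hy, hv⟩, hsub⟩
    obtain ⟨hh, ha⟩ := mem_prodSpace.1 ha
    obtain rfl := mem_funSpace.1 hh
    refine ⟨names_nonempty.2 ⟨a, ha, y, hy⟩, fun y' hy' j => ?_⟩
    obtain ⟨y, hyn, hy⟩ := (mem_names ha).1 hy'
    have hc := pair_mem_cylNames (j := j) hyn
    obtain ⟨r, hr, hd⟩ := PhiMulti_dom.1 (hdom y hy) _ hc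
    refine ⟨r, hr, (mem_names hx).2 ⟨_, Part.get_mem hd, hsub ⟨hdom, y, hy, ?_⟩⟩⟩
    exact mem_PhiMulti.2 ⟨hdom y hy, _, hc, r, hr, Part.get_mem hd⟩
  · rintro ⟨hne, h⟩
    obtain ⟨a, ha, y, hy⟩ := names_nonempty.1 hne
    have key : ∀ y ∈ g a, ∀ s ∈ cylNames Y y, ∃ r ∈ Phi (fstB q) s, ∃ v ∈ V.δ r, v ∈ f x := by
      intro y hy s hs
      obtain ⟨r, hr, hrf⟩ := h (fstB s) ((mem_names ha).2 ⟨y, hs, hy⟩) (sndB s)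
      rw [pair_fstB_sndB] at hr
      exact ⟨r, hr, (mem_names hx).1 hrf⟩
    have hdom : ∀ y ∈ g a, y ∈ (PhiMulti Y V (fstB q)).dom := by
      intro y hy
      refine PhiMulti_dom.2 fun s hs => ?_
      obtain ⟨r, hr, v, hv, -⟩ := key y hy s hs
      exact ⟨r, hr, Part.dom_iff_mem.2 ⟨v, hv⟩⟩
    refine ⟨(⟨PhiMulti Y V (fstB q), fstB q, rfl⟩, a), ?_, ?_, ?_⟩
    · exact mem_prodSpace.2 ⟨mem_funSpace.2 rfl, ha⟩
    · obtain ⟨v, hv⟩ := hdom y hy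
      exact ⟨v, hdom, y, hy, hv⟩
    · rintro v ⟨-, y, hy, hv⟩
      obtain ⟨-, s, hs, r, hr, hv⟩ := mem_PhiMulti.1 hv
      obtain ⟨r', hr', v', hv', hf⟩ := key y hy s hs
      obtain rfl := Part.mem_unique hr hr'
      rwa [Part.mem_unique hv hv']

theorem nameImpl_nonempty {g f : Baire → Set Baire} {u : Baire} (h : (nameImpl g f u).Nonempty) :
    (f u).Nonempty := by
  obtain ⟨q, ⟨y, hy⟩, h⟩ := h
  obtain ⟨r, -, hr⟩ := h y hy y
  exact ⟨r, hr⟩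

theorem names_impl {X Y U V : RepSpace} (g : MultiFun X Y) (f : MultiFun U V) :
    names (g.impl f) = nameImpl (names g) (names f) := by
  funext u
  by_cases hu : (names f u).Nonempty
  · exact names_impl_of_nonempty g f u hu
  · rw [Set.not_nonempty_iff_eq_empty.1 fun h => hu (nameImpl_nonempty h)]
    by_contra hne
    obtain ⟨x, hx, _, hc, hs⟩ := names_nonempty.1 (Set.nonempty_iff_ne_empty.2 hne)
    exact hu (names_nonempty.2 ⟨x, hx, hc.mono hs⟩)

/-- The outer composition requires that all values of the inner one lie in the domain of `f`. Since
representations are single-valued, this can be checked on the output of the program for each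
cylindrical name. The factor `idBaire` forces equality of the two Baire components. -/
theorem names_star {U V X Y : RepSpace} (f : MultiFun U V) (g : MultiFun X Y) :
    names (f.star g) = nameStar (names f) (names g) := by
  funext p
  ext q
  constructor
  · rintro ⟨⟨h, x⟩, ha, ⟨w, v⟩, hb, hdom, ⟨w', u⟩, ⟨hd, y, hy, hwu⟩, hw, hv⟩
    obtain ⟨hh, hx⟩ := mem_prodSpace.1 ha
    obtain rfl := mem_funSpace.1 hh
    obtain ⟨hbw, hbv⟩ := mem_prodSpace.1 hb
    refine ⟨fun y' hy' j => ?_, ?_⟩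
    · obtain ⟨y, hyn, hy⟩ := (mem_names hx).1 hy'
      have hc := pair_mem_cylNames (j := j) hyn
      obtain ⟨r, hr, hrd⟩ := PhiMulti_dom.1 (hd y hy) _ hc
      refine ⟨r, hr, ?_⟩
      obtain ⟨z, hz⟩ := Part.dom_iff_mem.1 hrd
      obtain ⟨t, -, ht⟩ := hdom z ⟨hd, y, hy, mem_PhiMulti.2 ⟨hd y hy, _, hc, r, hr, hz⟩⟩
      exact names_nonempty.2 ⟨z.2, (mem_prodSpace.1 hz).2, t.2, ht⟩
    · obtain ⟨-, s, hs, r, hr, hz⟩ := mem_PhiMulti.1 hwu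
      obtain ⟨hz1, hz2⟩ := mem_prodSpace.1 hz
      refine ⟨fstB s, ⟨x, hx, y, hs, hy⟩, sndB s, r, ?_, ?_, u, hz2, v, hbv, hv⟩
      · rwa [pair_fstB_sndB]
      · have e1 : w = fstB q := Part.mem_some_iff.1 hbw
        have e2 : w' = fstB r := Part.mem_some_iff.1 hz1
        have e3 : w = w' := hw
        rw [← e1, ← e2, e3]
  · rintro ⟨h, y', hy', j, r, hr, hqr, u, hu, v, hv, hf⟩
    obtain ⟨x, hx, y, hyn, hy⟩ := hy'
    have key : ∀ y ∈ g x, ∀ s ∈ cylNames Y y, ∃ r ∈ Phi (fstB p) s, ∃ u ∈ U.δ (sndB r),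
        u ∈ f.dom := by
      intro y hy s hs
      obtain ⟨r, hr, hrf⟩ := h (fstB s) ((mem_names hx).2 ⟨y, hs, hy⟩) (sndB s)
      rw [pair_fstB_sndB] at hr
      exact ⟨r, hr, names_nonempty.1 hrf⟩
    have hdom : ∀ y ∈ g x, y ∈ (PhiMulti Y (prodSpace baireSpace U) (fstB p)).dom := by
      intro y hy
      refine PhiMulti_dom.2 fun s hs => ?_
      obtain ⟨r, hr, u, hu, -⟩ := key y hy s hs
      exact ⟨r, hr, Part.dom_iff_mem.2 ⟨(fstB r, u),
        mem_prodSpace.2 ⟨Part.mem_some _, hu⟩⟩⟩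
    refine ⟨(⟨PhiMulti Y (prodSpace baireSpace U) (fstB p), fstB p, rfl⟩, x), ?_,
      (fstB q, v), mem_prodSpace.2 ⟨Part.mem_some _, hv⟩, ?_, (fstB q, u), ⟨hdom, y, hy, ?_⟩,
      rfl, hf⟩
    · exact mem_prodSpace.2 ⟨mem_funSpace.2 rfl, hx⟩
    · rintro ⟨w, z⟩ ⟨-, y, hy, hz⟩
      obtain ⟨-, s, hs, r, hr, hz⟩ := mem_PhiMulti.1 hz
      obtain ⟨r', hr', u', hu', t, ht⟩ := key y hy s hs
      obtain rfl := Part.mem_unique hr hr'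
      obtain rfl := Part.mem_unique (mem_prodSpace.1 hz).2 hu'
      exact ⟨(w, t), rfl, ht⟩
    · refine mem_PhiMulti.2 ⟨hdom y hy, _, pair_mem_cylNames (j := j) hyn, r, hr,
        mem_prodSpace.2 ⟨?_, hu⟩⟩
      rw [hqr]
      exact Part.mem_some _

/-! ## The reductions -/

/-- The program that ignores its input and writes a fixed solution of `f` works. It is not
computable in general, which is irrelevant for mere existence. -/
theorem nameImpl_nonempty_of {g f : Baire → Set Baire} {z u : Baire} (hg : (g z).Nonempty)
    (hf : (f u).Nonempty) : (nameImpl g f u).Nonempty := by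
  obtain ⟨S, -, hS⟩ := IsComputable.exists_curry ComputableMap.id.fst
  obtain ⟨v, hv⟩ := hf
  refine ⟨pair (S v) z, ?_, fun y _ j => ⟨v, ?_, hv⟩⟩
  · rwa [sndB_pair]
  · rw [fstB_pair]
    exact hS _ _ _ (Part.mem_some_iff.2 (fstB_pair _ _).symm)

theorem nameStar_nonempty_iff {f g : Baire → Set Baire} {p : Baire} :
    (nameStar f g p).Nonempty ↔ (g (sndB p)).Nonempty ∧
      ∀ y ∈ g (sndB p), ∀ j, ∃ r ∈ Phi (fstB p) (pair y j), (f (sndB r)).Nonempty := by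
  constructor
  · rintro ⟨q, h, y, hy, -⟩
    exact ⟨⟨y, hy⟩, h⟩
  · rintro ⟨⟨y, hy⟩, h⟩
    obtain ⟨r, hr, v, hv⟩ := h y hy y
    exact ⟨pair (fstB r) v, h, y, hy, y, r, hr, fstB_pair _ _, by rwa [sndB_pair]⟩

/-- With `q` = ⟨k, ⟨e, x⟩⟩, run `e` on a solution of `a` at `x`. This yields side information `w`
and an instance of `b`; emit that instance together with the program that, on a solution `v`, runs
`k` on ⟨w, v⟩. -/
theorem exists_uncurry_impl : ∃ T : Baire → Baire, ComputableMap T ∧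
    ∀ (a b c : Baire → Set Baire) (u q : Baire), q ∈ nameImpl (nameStar b a) c u →
      T q ∈ nameImpl a (nameImpl b c) u := by
  have i := ComputableMap.id
  -- `S'` produces the inner program, depending on `k` and the output of `e`; `S` below produces the
  -- outer program, which runs `e` and calls `S'`.
  obtain ⟨S', hS', hS'Φ⟩ := IsComputable.exists_curry
    (i.fst.fst.fst.phi ((i.fst.snd.fst.pair i.snd.fst).pair i.snd.snd))
  obtain ⟨S, hS, hSΦ⟩ := IsComputable.exists_curry
    ((i.fst.snd.fst.phi i.snd).map_pair
      (ComputableMap.pair (hS'.comp (i.fst.fst.pair i.snd)) i.snd.snd))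
  refine ⟨fun q => pair (S q) (sndB (sndB q)), ComputableMap.pair hS i.snd.snd, ?_⟩
  intro a b c u q hq
  obtain ⟨hne, h⟩ := hq
  obtain ⟨hx, hstar⟩ := nameStar_nonempty_iff.1 hne
  refine ⟨by rwa [sndB_pair], fun y hy j => ?_⟩
  rw [sndB_pair] at hy
  rw [fstB_pair]
  obtain ⟨r, hr, hb⟩ := hstar y hy j
  refine ⟨_, hSΦ q (pair y j) _ ((Part.mem_map_iff _).2 ⟨r, ?_, rfl⟩), ?_, ?_⟩
  · simpa only [fstB_pair, sndB_pair] using hr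
  · simpa only [fstB_pair, sndB_pair] using hb
  · intro v hv k
    simp only [fstB_pair, sndB_pair] at hv ⊢
    obtain ⟨r', hr', hc⟩ := h (pair (fstB r) v)
      ⟨hstar, y, hy, j, r, hr, fstB_pair _ _, by rwa [sndB_pair]⟩ k
    exact ⟨r', hS'Φ _ _ _ (by simpa only [fstB_pair, sndB_pair] using hr'), hc⟩

/-- The program in `q` already yields an inner program and an instance of `b`. Read as a program for
⋆, it puts the inner program into the Baire factor, and a fixed universal program applies it to the
solution of `b`. -/
theorem exists_curry_impl : ∃ T : Baire → Baire, ComputableMap T ∧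
    ∀ (a b c : Baire → Set Baire) (u q : Baire), q ∈ nameImpl a (nameImpl b c) u →
      T q ∈ nameImpl (nameStar b a) c u := by
  have i := ComputableMap.id
  obtain ⟨e, he, heΦ⟩ := i.fst.fst.phi (i.fst.snd.pair i.snd)
  refine ⟨fun q => pair e q, (ComputableMap.const he).pair i, ?_⟩
  rintro a b c u q ⟨hx, h⟩
  refine ⟨?_, ?_⟩
  · rw [sndB_pair]
    refine nameStar_nonempty_iff.2 ⟨hx, fun y hy j => ?_⟩
    obtain ⟨r, hr, hb, -⟩ := h y hy j
    exact ⟨r, hr, hb⟩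
  · intro t ht k
    rw [sndB_pair] at ht
    rw [fstB_pair]
    obtain ⟨-, y, hy, j, r, hr, htr, hv⟩ := ht
    obtain ⟨r', hr', -, h'⟩ := h y hy j
    obtain rfl := Part.mem_unique hr hr'
    obtain ⟨s, hs, hc⟩ := h' _ hv k
    exact ⟨s, heΦ _ _ (by simpa only [fstB_pair, sndB_pair, htr] using hs), hc⟩

/-- Instances stay the same and solutions are translated uniformly. The opposite translation is used
only to see that the target has a solution. -/
theorem impl_impl_le (a b c : Baire → Set Baire) :
    NameReducible (nameImpl a (nameImpl b c)) (nameImpl (nameStar b a) c) := by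
  obtain ⟨T, hT, h⟩ := exists_uncurry_impl
  obtain ⟨T', -, h'⟩ := exists_curry_impl
  exact .mk_total (hT.comp ComputableMap.id.snd) ComputableMap.id fun p ⟨q, hq⟩ =>
    ⟨⟨_, h' a b c p q hq⟩, fun r hr => by rw [sndB_pair]; exact h a b c p r hr⟩

theorem le_impl_impl (a b c : Baire → Set Baire) :
    NameReducible (nameImpl (nameStar b a) c) (nameImpl a (nameImpl b c)) := by
  obtain ⟨T, -, h⟩ := exists_uncurry_impl
  obtain ⟨T', hT', h'⟩ := exists_curry_impl
  exact .mk_total (hT'.comp ComputableMap.id.snd) ComputableMap.id fun p ⟨q, hq⟩ =>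
    ⟨⟨_, h a b c p q hq⟩, fun r hr => by rw [sndB_pair]; exact h' a b c p r hr⟩

/-- The same instance serves on both sides. The right side delivers side information and a solution
of a → b; attaching the side information to the output of its program gives a solution of the left
side. -/
theorem impl_star_le (a b c : Baire → Set Baire) :
    NameReducible (nameImpl a (nameStar b c)) (nameStar (nameImpl a b) c) := by
  have i := ComputableMap.id
  obtain ⟨S, hS, hSΦ⟩ := IsComputable.exists_curry
    ((i.fst.snd.phi i.snd).map_pair (i.fst.fst.fst.pair i.snd))
  refine .mk_total (K := fun t => pair (S (pair (fstB (sndB t)) (fstB (sndB (sndB t)))))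
    (sndB (sndB (sndB t)))) (ComputableMap.pair (hS.comp (i.snd.fst.pair i.snd.snd.fst))
      i.snd.snd.snd) i fun p hp => ?_
  obtain ⟨hcx, hbr⟩ := nameStar_nonempty_iff.1 (nameImpl_nonempty hp)
  obtain ⟨_, ⟨y₀, hy₀⟩, -⟩ := hp
  refine ⟨nameStar_nonempty_iff.2 ⟨hcx, fun y hy j => ?_⟩, ?_⟩
  · obtain ⟨r, hr, hb⟩ := hbr y hy j
    exact ⟨r, hr, nameImpl_nonempty_of ⟨y₀, hy₀⟩ hb⟩
  · rintro q ⟨-, y, hy, j, r, hr, hqr, hz, hH⟩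
    refine ⟨by simpa only [sndB_pair] using hz, fun y' hy' j' => ?_⟩
    simp only [fstB_pair, sndB_pair] at hy' ⊢
    obtain ⟨r', hr', hb⟩ := hH y' hy' j'
    refine ⟨_, hSΦ _ _ _ ((Part.mem_map_iff _).2 ⟨r', ?_, rfl⟩), hbr, y, hy, j, r, hr, ?_, ?_⟩
    · simpa only [fstB_pair, sndB_pair] using hr'
    · simpa only [fstB_pair, sndB_pair] using hqr
    · simpa only [fstB_pair, sndB_pair] using hb

/-- Tag the instance and strip the tag from the solution before running the old program. A solution
carries the tag of its instance, so the other summand never has to be handled. -/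
theorem exists_impl_of_coprod : ∃ T : Baire → Baire, ComputableMap T ∧
    ∀ (a b c : Baire → Set Baire) (u t q : Baire),
      (t 0 = 0 → q ∈ nameImpl a c u → T (pair t q) ∈ nameImpl (nameCoprod a b) c u) ∧
      (t 0 = 1 → q ∈ nameImpl b c u → T (pair t q) ∈ nameImpl (nameCoprod a b) c u) := by
  have i := ComputableMap.id
  obtain ⟨S, hS, hSΦ⟩ := IsComputable.exists_curry (i.fst.phi (i.snd.fst.tail.pair i.snd.snd))
  refine ⟨fun s => pair (S (fstB (sndB s))) (withHead (fstB s) (sndB (sndB s))),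
    ComputableMap.pair (hS.comp i.snd.fst) (i.fst.withHead i.snd.snd), fun a b c u t q => ?_⟩
  refine ⟨fun ht ⟨hx, h⟩ => ?_, fun ht ⟨hx, h⟩ => ?_⟩
  · simp only [fstB_pair, sndB_pair]
    constructor
    · obtain ⟨y, hy⟩ := hx
      rw [sndB_pair]
      exact ⟨withHead t y, Or.inl ⟨ht, ht, hy⟩⟩
    · intro y hy j
      simp only [fstB_pair, sndB_pair] at hy ⊢
      obtain ⟨-, -, hy⟩ | ⟨h1, -, -⟩ := hy
      · obtain ⟨r, hr, hc⟩ := h _ hy j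
        exact ⟨r, hSΦ _ _ _ (by simpa only [fstB_pair, sndB_pair] using hr), hc⟩
      · rw [withHead_zero, ht] at h1
        cases h1
  · simp only [fstB_pair, sndB_pair]
    constructor
    · obtain ⟨y, hy⟩ := hx
      rw [sndB_pair]
      exact ⟨withHead t y, Or.inr ⟨ht, ht, hy⟩⟩
    · intro y hy j
      simp only [fstB_pair, sndB_pair] at hy ⊢
      obtain ⟨h1, -, -⟩ | ⟨-, -, hy⟩ := hy
      · rw [withHead_zero, ht] at h1
        cases h1
      · obtain ⟨r, hr, hc⟩ := h _ hy j
        exact ⟨r, hSΦ _ _ _ (by simpa only [fstB_pair, sndB_pair] using hr), hc⟩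

theorem coprod_impl_le_meet {a b : Baire → Set Baire} (c : Baire → Set Baire)
    (ha : ∃ x, (a x).Nonempty) (hb : ∃ x, (b x).Nonempty) :
    NameReducible (nameImpl (nameCoprod a b) c) (nameMeet (nameImpl a c) (nameImpl b c)) := by
  have i := ComputableMap.id
  obtain ⟨T, hT, h⟩ := exists_impl_of_coprod
  obtain ⟨x, hx⟩ := ha
  obtain ⟨x', hx'⟩ := hb
  refine .mk_total (hT.comp (i.snd.pair i.snd.tail)) (i.pair i) fun p hp => ?_
  have hc := nameImpl_nonempty hp
  constructor
  · obtain ⟨q, hq⟩ := nameImpl_nonempty_of (g := a) hx hc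
    refine ⟨withHead (fun _ => 0) q, ?_, ?_, Or.inl ⟨rfl, ?_⟩⟩
    · rw [fstB_pair]; exact ⟨q, hq⟩
    · rw [sndB_pair]; exact nameImpl_nonempty_of hx' hc
    · rwa [fstB_pair]
  · rintro q ⟨-, -, ⟨h0, hq⟩ | ⟨h1, hq⟩⟩
    · rw [fstB_pair] at hq
      rw [sndB_pair]
      exact (h a b c p _ _).1 h0 hq
    · rw [sndB_pair] at hq
      rw [sndB_pair]
      exact (h a b c p _ _).2 h1 hq

theorem computable_constSeq (n : ℕ) : Computable (fun _ => n : Baire) := Computable.const n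

/-- This covers empty dom b with non-empty dom c: then b → c is ∞, and the meet collapses to a → c.
-/
theorem coprod_impl_le_left {a : Baire → Set Baire} (b c : Baire → Set Baire)
    (ha : ∃ x, (a x).Nonempty) : NameReducible (nameImpl (nameCoprod a b) c) (nameImpl a c) := by
  have i := ComputableMap.id
  obtain ⟨T, hT, h⟩ := exists_impl_of_coprod
  obtain ⟨x, hx⟩ := ha
  refine .mk_total (hT.comp ((ComputableMap.const (computable_constSeq 0)).pair i.snd)) i
    fun p hp => ⟨nameImpl_nonempty_of hx (nameImpl_nonempty hp), fun q hq => ?_⟩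
  rw [sndB_pair]
  exact (h a b c p _ _).1 rfl hq

theorem coprod_impl_le_right (a : Baire → Set Baire) {b : Baire → Set Baire} (c : Baire → Set Baire)
    (hb : ∃ x, (b x).Nonempty) : NameReducible (nameImpl (nameCoprod a b) c) (nameImpl b c) := by
  have i := ComputableMap.id
  obtain ⟨T, hT, h⟩ := exists_impl_of_coprod
  obtain ⟨x, hx⟩ := hb
  refine .mk_total (hT.comp ((ComputableMap.const (computable_constSeq 1)).pair i.snd)) i
    fun p hp => ⟨nameImpl_nonempty_of hx (nameImpl_nonempty hp), fun q hq => ?_⟩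
  rw [sndB_pair]
  exact (h a b c p _ _).2 rfl hq

/-- A solution of the right side holds instances of both `a` and `b`. The tag of the given instance
selects one of them, and the program is fed a solution with that tag prepended, which is a
legitimate solution of the meet. -/
theorem impl_coprod_impl_le {a b : Baire → Set Baire} (c : Baire → Set Baire)
    (ha : ∃ x, (a x).Nonempty) (hb : ∃ x, (b x).Nonempty) :
    NameReducible (nameCoprod (nameImpl a c) (nameImpl b c)) (nameImpl (nameMeet a b) c) := by
  have i := ComputableMap.id
  obtain ⟨S, hS, hSΦ⟩ := IsComputable.exists_curry
    (i.fst.snd.phi ((i.fst.fst.withHead i.snd.fst).pair i.snd.snd))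
  have hK : ComputableMap fun t => withHead (fstB t) (pair (S (pair (fstB t) (fstB (sndB t))))
      (if fstB t 0 = 0 then fstB (sndB (sndB t)) else sndB (sndB (sndB t)))) :=
    i.fst.withHead (ComputableMap.pair (hS.comp (i.fst.pair i.snd.fst))
      (.ite i.fst i.snd.snd.fst i.snd.snd.snd))
  obtain ⟨x, y, hy⟩ := ha
  obtain ⟨x', hb'⟩ := hb
  have hne : (nameMeet a b (pair x x')).Nonempty := by
    refine ⟨withHead (fun _ => 0) y, ?_, ?_, Or.inl ⟨rfl, ?_⟩⟩
    · rw [fstB_pair]; exact ⟨y, hy⟩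
    · rwa [sndB_pair]
    · rwa [fstB_pair]
  refine .mk_total hK i.tail fun p hp => ?_
  have hc : (c (tailB p)).Nonempty := by
    obtain ⟨q, ⟨-, -, hq⟩ | ⟨-, -, hq⟩⟩ := hp <;> exact nameImpl_nonempty ⟨_, hq⟩
  refine ⟨nameImpl_nonempty_of hne hc, ?_⟩
  rintro q ⟨⟨_, hx, hx', -⟩, h⟩
  simp only [fstB_pair, sndB_pair]
  obtain ⟨_, ⟨h0, -, -⟩ | ⟨h1, -, -⟩⟩ := hp
  · refine Or.inl ⟨h0, h0, ?_, ?_⟩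
    · simpa [sndB_pair, h0] using hx
    · intro y hy j
      simp only [tailB_withHead, fstB_pair, sndB_pair, h0, if_true] at hy ⊢
      obtain ⟨r, hr, hc⟩ := h (withHead p y) ⟨hx, hx', Or.inl ⟨h0, hy⟩⟩ j
      exact ⟨r, hSΦ _ _ _ (by simpa only [fstB_pair, sndB_pair] using hr), hc⟩
  · refine Or.inr ⟨h1, h1, ?_, ?_⟩
    · simpa [sndB_pair, h1] using hx'
    · intro y hy j
      simp only [tailB_withHead, fstB_pair, sndB_pair, h1, one_ne_zero, if_false] at hy ⊢
      obtain ⟨r, hr, hc⟩ := h (withHead p y) ⟨hx, hx', Or.inr ⟨h1, hy⟩⟩ j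
      exact ⟨r, hSΦ _ _ _ (by simpa only [fstB_pair, sndB_pair] using hr), hc⟩

/-- Needed when a premise of an implication is ∞, which makes that summand equal to 0. -/
theorem coprod_le_of_empty_left {a : Baire → Set Baire} (b : Baire → Set Baire)
    (ha : ∀ x, ¬ (a x).Nonempty) : NameReducible (nameCoprod a b) b := by
  have i := ComputableMap.id
  refine .mk_total (i.fst.withHead i.snd) i.tail fun p hp => ?_
  obtain ⟨_, ⟨-, -, h⟩ | ⟨hp, -, h⟩⟩ := hp
  · exact (ha _ ⟨_, h⟩).elim
  · refine ⟨⟨_, h⟩, fun q hq => ?_⟩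
    rw [fstB_pair, sndB_pair]
    exact Or.inr ⟨hp, hp, hq⟩

theorem coprod_le_of_empty_right (a : Baire → Set Baire) {b : Baire → Set Baire}
    (hb : ∀ x, ¬ (b x).Nonempty) : NameReducible (nameCoprod a b) a := by
  have i := ComputableMap.id
  refine .mk_total (i.fst.withHead i.snd) i.tail fun p hp => ?_
  obtain ⟨_, ⟨hp, -, h⟩ | ⟨-, -, h⟩⟩ := hp
  · refine ⟨⟨_, h⟩, fun q hq => ?_⟩
    rw [fstB_pair, sndB_pair]
    exact Or.inl ⟨hp, hp, hq⟩
  · exact (hb _ ⟨_, h⟩).elim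

/-- The independent call to `a` can be made alongside the first call or alongside the second. The
answer of the meet is tagged, so the output map knows how to rearrange it. -/
theorem prod_star_le (a b c : Baire → Set Baire) : NameReducible (nameProd a (nameStar b c))
    (nameMeet (nameStar b (nameProd a c)) (nameStar (nameProd a b) c)) := by
  have i := ComputableMap.id
  -- `S₁` hands a solution of `a`, obtained beside that of `c`, through the Baire factor; `S₂`
  -- passes on an instance of `a` to be solved beside `b`.
  obtain ⟨S₁, hS₁, hΦ₁⟩ := IsComputable.exists_curry
    ((i.fst.phi (i.snd.fst.snd.pair i.snd.snd)).map_pair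
      ((i.fst.snd.fst.fst.pair i.snd.fst).pair i.snd.snd))
  obtain ⟨S₂, hS₂, hΦ₂⟩ := IsComputable.exists_curry
    ((i.fst.fst.phi i.snd).map_pair (i.snd.fst.pair (i.fst.fst.snd.pair i.snd.snd)))
  refine .mk_total (K := fun t => if sndB t 0 = 0
      then pair (fstB (fstB (tailB (sndB t))))
        (pair (sndB (fstB (tailB (sndB t)))) (sndB (tailB (sndB t))))
      else pair (fstB (sndB (tailB (sndB t))))
        (pair (fstB (tailB (sndB t))) (sndB (sndB (tailB (sndB t))))))
    (H := fun p => pair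
      (pair (S₁ (fstB (sndB p))) (pair (fstB p) (sndB (sndB p))))
      (pair (S₂ (pair (fstB (sndB p)) (fstB p))) (sndB (sndB p))))
    (.ite i.snd (i.snd.tail.fst.fst.pair (i.snd.tail.fst.snd.pair i.snd.tail.snd))
      (i.snd.tail.snd.fst.pair (i.snd.tail.fst.pair i.snd.tail.snd.snd)))
    ((ComputableMap.pair (hS₁.comp i.snd.fst) (i.fst.pair i.snd.snd)).pair
      (ComputableMap.pair (hS₂.comp (i.snd.fst.pair i.fst)) i.snd.snd)) fun p hp => ?_
  obtain ⟨q₀, ⟨ha, hst⟩⟩ := hp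
  obtain ⟨⟨z, hz⟩, hb⟩ := nameStar_nonempty_iff.1 ⟨_, hst⟩
  have key₁ : ∀ {y w j r}, r ∈ Phi (fstB (sndB p)) (pair w j) →
      pair (pair y (fstB r)) (sndB r) ∈ Phi (S₁ (fstB (sndB p))) (pair (pair y w) j) := by
    intro y w j r hr
    refine hΦ₁ _ _ _ ((Part.mem_map_iff _).2 ⟨r, ?_, ?_⟩)
    · simpa only [fstB_pair, sndB_pair] using hr
    · simp only [fstB_pair, sndB_pair]
  have key₂ : ∀ {w j r}, r ∈ Phi (fstB (sndB p)) (pair w j) →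
      pair (fstB r) (pair (fstB p) (sndB r)) ∈
        Phi (S₂ (pair (fstB (sndB p)) (fstB p))) (pair w j) := by
    intro w j r hr
    refine hΦ₂ _ _ _ ((Part.mem_map_iff _).2 ⟨r, ?_, ?_⟩)
    · simpa only [fstB_pair, sndB_pair] using hr
    · simp only [fstB_pair, sndB_pair]
  constructor
  · have h₁ : (nameStar b (nameProd a c)
        (pair (S₁ (fstB (sndB p))) (pair (fstB p) (sndB (sndB p))))).Nonempty := by
      rw [nameStar_nonempty_iff]
      simp only [fstB_pair, sndB_pair]
      refine ⟨⟨pair (fstB q₀) z, ?_⟩, fun y hy j => ?_⟩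
      · simp only [nameProd, Set.mem_ofPred_eq, fstB_pair, sndB_pair]
        exact ⟨ha, hz⟩
      · obtain ⟨hy1, hy2⟩ := hy
        rw [sndB_pair] at hy2
        obtain ⟨r, hr, hbr⟩ := hb _ hy2 j
        refine ⟨_, by simpa only [pair_fstB_sndB] using key₁ (y := fstB y) hr, ?_⟩
        rwa [sndB_pair]
    have h₂ : (nameStar (nameProd a b) c
        (pair (S₂ (pair (fstB (sndB p)) (fstB p))) (sndB (sndB p)))).Nonempty := by
      rw [nameStar_nonempty_iff]
      simp only [fstB_pair, sndB_pair]
      refine ⟨⟨z, hz⟩, fun y hy j => ?_⟩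
      obtain ⟨r, hr, v, hv⟩ := hb _ hy j
      refine ⟨_, key₂ hr, pair (fstB q₀) v, ?_⟩
      simp only [nameProd, Set.mem_ofPred_eq, fstB_pair, sndB_pair]
      exact ⟨ha, hv⟩
    obtain ⟨q, hq⟩ := h₁
    refine ⟨withHead (fun _ => 0) q, ?_, ?_, Or.inl ⟨rfl, ?_⟩⟩
    · rw [fstB_pair]; exact ⟨q, hq⟩
    · rwa [sndB_pair]
    · rwa [fstB_pair]
  · rintro q ⟨-, -, ⟨h0, -, y, hy, j, r, hr, hqr, hv⟩ | ⟨h1, -, y, hy, j, r, hr, hqr, hv⟩⟩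
    · simp only [fstB_pair, sndB_pair] at hy hr
      obtain ⟨hy1, hy2⟩ := hy
      simp only [fstB_pair, sndB_pair] at hy1 hy2
      obtain ⟨r', hr', -⟩ := hb _ hy2 j
      have := key₁ (y := fstB y) hr'
      rw [pair_fstB_sndB] at this
      -- The modified program has only one output, so the answer is tied to a run of the original
      -- one.
      obtain rfl := Part.mem_unique hr this
      rw [fstB_pair] at hqr
      rw [sndB_pair] at hv
      simp only [sndB_pair, h0, if_true, hqr, fstB_pair]
      refine ⟨by rwa [fstB_pair], ?_⟩
      rw [sndB_pair]
      exact ⟨hb, _, hy2, j, r', hr', fstB_pair _ _, by rwa [sndB_pair]⟩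
    · simp only [fstB_pair, sndB_pair] at hy hr
      obtain ⟨r', hr', -⟩ := hb _ hy j
      obtain rfl := Part.mem_unique hr (key₂ hr')
      obtain ⟨hv1, hv2⟩ := hv
      simp only [fstB_pair, sndB_pair] at hqr hv1 hv2
      simp only [sndB_pair, h1, one_ne_zero, if_false, hqr]
      refine ⟨by rwa [fstB_pair], ?_⟩
      rw [sndB_pair]
      exact ⟨hb, _, hy, j, r', hr', fstB_pair _ _, by rwa [sndB_pair]⟩

/-- The parallel execution of two programs. -/
theorem exists_parallel : ∃ S : Baire → Baire, ComputableMap S ∧ ∀ e e' y y' j r r' : Baire,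
    r ∈ Phi e (pair y j) → r' ∈ Phi e' (pair y' j) →
    pair (pair (fstB r) (fstB r')) (pair (sndB r) (sndB r')) ∈
      Phi (S (pair e e')) (pair (pair y y') j) := by
  have i := ComputableMap.id
  obtain ⟨S, hS, hΦ⟩ := IsComputable.exists_curry
    (((i.fst.fst.phi (i.snd.fst.fst.pair i.snd.snd)).pair
      (i.fst.snd.phi (i.snd.fst.snd.pair i.snd.snd))).map_pair
      ((i.snd.fst.fst.pair i.snd.snd.fst).pair (i.snd.fst.snd.pair i.snd.snd.snd)))
  refine ⟨S, hS, fun e e' y y' j r r' hr hr' => hΦ _ _ _ ((Part.mem_map_iff _).2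
    ⟨pair r r', Part.mem_bind (a := r) ?_ ((Part.mem_map_iff _).2 ⟨r', ?_, rfl⟩), ?_⟩)⟩
  · simpa only [fstB_pair, sndB_pair] using hr
  · simpa only [fstB_pair, sndB_pair] using hr'
  · simp only [fstB_pair, sndB_pair]

theorem star_prod_star_le (a b c d : Baire → Set Baire) :
    NameReducible (nameProd (nameStar a c) (nameStar b d))
      (nameStar (nameProd a b) (nameProd c d)) := by
  have i := ComputableMap.id
  obtain ⟨S, hS, hΦ⟩ := exists_parallel
  refine .mk_total
    (K := fun t => pair (pair (fstB (fstB (sndB t))) (fstB (sndB (sndB t))))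
      (pair (sndB (fstB (sndB t))) (sndB (sndB (sndB t)))))
    (H := fun p => pair (S (pair (fstB (fstB p)) (fstB (sndB p))))
      (pair (sndB (fstB p)) (sndB (sndB p))))
    ((i.snd.fst.fst.pair i.snd.snd.fst).pair (i.snd.fst.snd.pair i.snd.snd.snd))
    (ComputableMap.pair (hS.comp (i.fst.fst.pair i.snd.fst)) (i.fst.snd.pair i.snd.snd))
    fun p ⟨q₀, hq₁, hq₂⟩ => ?_
  obtain ⟨⟨y₀, hy₀⟩, ha⟩ := nameStar_nonempty_iff.1 ⟨_, hq₁⟩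
  obtain ⟨⟨y₁, hy₁⟩, hb⟩ := nameStar_nonempty_iff.1 ⟨_, hq₂⟩
  constructor
  · rw [nameStar_nonempty_iff]
    simp only [fstB_pair, sndB_pair]
    refine ⟨⟨pair y₀ y₁, ?_⟩, fun y hy j => ?_⟩
    · simp only [nameProd, Set.mem_ofPred_eq, fstB_pair, sndB_pair]
      exact ⟨hy₀, hy₁⟩
    · obtain ⟨hyc, hyd⟩ := hy
      rw [fstB_pair] at hyc
      rw [sndB_pair] at hyd
      obtain ⟨r, hr, v, hv⟩ := ha _ hyc j
      obtain ⟨r', hr', v', hv'⟩ := hb _ hyd j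
      have := hΦ _ _ _ _ _ _ _ hr hr'
      rw [pair_fstB_sndB y] at this
      refine ⟨_, this, pair v v', ?_⟩
      simp only [nameProd, Set.mem_ofPred_eq, fstB_pair, sndB_pair]
      exact ⟨hv, hv'⟩
  · rintro q ⟨-, y, ⟨hyc, hyd⟩, j, r, hr, hqr, hva, hvb⟩
    simp only [fstB_pair, sndB_pair] at hyc hyd hr
    obtain ⟨s, hs, -⟩ := ha _ hyc j
    obtain ⟨s', hs', -⟩ := hb _ hyd j
    have := hΦ _ _ _ _ _ _ _ hs hs'
    rw [pair_fstB_sndB y] at this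
    obtain rfl := Part.mem_unique hr this
    simp only [fstB_pair, sndB_pair] at hqr hva hvb
    simp only [sndB_pair, hqr, fstB_pair]
    refine ⟨?_, ?_⟩
    · rw [fstB_pair]
      exact ⟨ha, _, hyc, j, s, hs, fstB_pair _ _, by rwa [sndB_pair]⟩
    · rw [sndB_pair]
      exact ⟨hb, _, hyd, j, s', hs', fstB_pair _ _, by rwa [sndB_pair]⟩

/-- Both first-stage problems are solved and both programs are run. The tag of the final answer
tells which side information belongs to it. -/
theorem star_meet_star_le (a b c d : Baire → Set Baire) :
    NameReducible (nameMeet (nameStar a c) (nameStar b d))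
      (nameStar (nameMeet a b) (nameProd c d)) := by
  have i := ComputableMap.id
  obtain ⟨S, hS, hΦ⟩ := exists_parallel
  refine .mk_total
    (K := fun t => withHead (sndB (sndB t)) (pair (if sndB (sndB t) 0 = 0
      then fstB (fstB (sndB t)) else sndB (fstB (sndB t))) (tailB (sndB (sndB t)))))
    (H := fun p => pair (S (pair (fstB (fstB p)) (fstB (sndB p))))
      (pair (sndB (fstB p)) (sndB (sndB p))))
    (i.snd.snd.withHead (ComputableMap.pair (.ite i.snd.snd i.snd.fst.fst i.snd.fst.snd)
      i.snd.snd.tail))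
    (ComputableMap.pair (hS.comp (i.fst.fst.pair i.snd.fst)) (i.fst.snd.pair i.snd.snd))
    fun p ⟨q₀, hq₁, hq₂, _⟩ => ?_
  obtain ⟨⟨y₀, hy₀⟩, ha⟩ := nameStar_nonempty_iff.1 hq₁
  obtain ⟨⟨y₁, hy₁⟩, hb⟩ := nameStar_nonempty_iff.1 hq₂
  constructor
  · rw [nameStar_nonempty_iff]
    simp only [fstB_pair, sndB_pair]
    refine ⟨⟨pair y₀ y₁, ?_⟩, fun y hy j => ?_⟩
    · simp only [nameProd, Set.mem_ofPred_eq, fstB_pair, sndB_pair]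
      exact ⟨hy₀, hy₁⟩
    · obtain ⟨hyc, hyd⟩ := hy
      rw [fstB_pair] at hyc
      rw [sndB_pair] at hyd
      obtain ⟨r, hr, v, hv⟩ := ha _ hyc j
      obtain ⟨r', hr', hv'⟩ := hb _ hyd j
      have := hΦ _ _ _ _ _ _ _ hr hr'
      rw [pair_fstB_sndB y] at this
      refine ⟨_, this, withHead (fun _ => 0) v, ?_⟩
      simp only [nameMeet, Set.mem_ofPred_eq, fstB_pair, sndB_pair]
      exact ⟨⟨v, hv⟩, hv', Or.inl ⟨rfl, hv⟩⟩
  · rintro q ⟨-, y, ⟨hyc, hyd⟩, j, r, hr, hqr, -, -, h⟩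
    simp only [fstB_pair, sndB_pair] at hyc hyd hr
    obtain ⟨s, hs, -⟩ := ha _ hyc j
    obtain ⟨s', hs', -⟩ := hb _ hyd j
    have := hΦ _ _ _ _ _ _ _ hs hs'
    rw [pair_fstB_sndB y] at this
    obtain rfl := Part.mem_unique hr this
    simp only [fstB_pair, sndB_pair] at hqr h
    refine ⟨hq₁, hq₂, ?_⟩
    obtain ⟨h0, hv⟩ | ⟨h1, hv⟩ := h
    · simp only [sndB_pair, hqr, fstB_pair, h0, if_true, tailB_withHead]
      exact Or.inl ⟨h0, ha, _, hyc, j, s, hs, fstB_pair _ _, by rwa [sndB_pair]⟩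
    · simp only [sndB_pair, hqr, fstB_pair, h1, one_ne_zero, if_false, tailB_withHead]
      exact Or.inr ⟨h1, hb, _, hyd, j, s', hs', fstB_pair _ _, by rwa [sndB_pair]⟩

theorem prod_le_star (f g : Baire → Set Baire) :
    NameReducible (nameProd f g) (nameStar f g) := by
  have i := ComputableMap.id
  -- The program keeps the solution of `g` as side information and always asks for the instance of
  -- `f` built into it.
  obtain ⟨S, hS, hΦ⟩ := IsComputable.exists_curry (i.snd.fst.pair i.fst)
  have key : ∀ u y j, pair y u ∈ Phi (S u) (pair y j) := fun u y j =>
    hΦ _ _ _ (by simp only [fstB_pair, sndB_pair]; exact Part.mem_some _)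
  refine .mk_total (K := fun t => pair (sndB (sndB t)) (fstB (sndB t)))
    (H := fun p => pair (S (fstB p)) (sndB p)) (i.snd.snd.pair i.snd.fst)
    (ComputableMap.pair (hS.comp i.fst) i.snd) fun p ⟨q₀, hf, hg⟩ => ?_
  constructor
  · rw [nameStar_nonempty_iff]
    simp only [fstB_pair, sndB_pair]
    exact ⟨⟨_, hg⟩, fun y _ j => ⟨_, key _ y j, _, by rwa [sndB_pair]⟩⟩
  · rintro q ⟨-, y, hy, j, r, hr, hqr, hv⟩
    simp only [fstB_pair, sndB_pair] at hy hr
    obtain rfl := Part.mem_unique hr (key _ _ _)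
    simp only [fstB_pair, sndB_pair] at hqr hv
    simp only [nameProd, Set.mem_ofPred_eq, sndB_pair, fstB_pair, hqr]
    exact ⟨hv, hy⟩

/-- If the solutions of `f` do not depend on the instance, then `f ⋆ g` reduces to `f × g`. -/
theorem star_le_prod {f g : Baire → Set Baire} (hf : ∀ u u', f u = f u') :
    NameReducible (nameStar f g) (nameProd f g) := by
  have i := ComputableMap.id
  -- The instance given to `f` is immaterial, so `f` is queried without waiting for `g`. Afterwards
  -- the program is run on the solution of `g`, merely to recover the side information; the
  -- auxiliary part of its input may be anything.
  have hK := (i.fst.fst.phi (i.snd.snd.pair i.snd.snd)).map_pair (i.snd.fst.pair i.fst.snd.fst)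
  refine .mk hK (i.snd.pair i.snd) fun p hp => ?_
  obtain ⟨⟨y, hy⟩, h⟩ := nameStar_nonempty_iff.1 hp
  constructor
  · obtain ⟨r, hr, v, hv⟩ := h y hy y
    refine ⟨pair v y, ?_, ?_⟩
    · rw [hf _ (sndB r)]
      rwa [fstB_pair]
    · rwa [sndB_pair, sndB_pair]
  · rintro q ⟨hq1, hq2⟩
    rw [sndB_pair] at hq2
    obtain ⟨r, hr, -⟩ := h _ hq2 (sndB q)
    refine ⟨_, (Part.mem_map_iff _).2 ⟨r, by simpa only [fstB_pair, sndB_pair] using hr, rfl⟩,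
      h, _, hq2, _, r, hr, ?_, ?_⟩
    · simp only [fstB_pair, sndB_pair]
    · simp only [fstB_pair, sndB_pair]
      rwa [hf _ (fstB (pair (sndB p) (sndB p)))]

/-- The identity of the one-point space on names. -/
def nameOne (_ : Baire) : Set Baire := Set.univ

/-- Only a name of a point in dom a is at stake. The identity program does for the rest, and any
name serves as the second component of an instance of the meet. -/
theorem meet_one_impl_le (a : Baire → Set Baire) :
    NameReducible (nameImpl (nameMeet a nameOne) nameOne) (nameImpl a nameOne) := by
  have i := ComputableMap.id
  obtain ⟨e, he, heΦ⟩ := i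
  have i := ComputableMap.id
  refine .mk_total (K := fun t => pair e (pair (sndB (sndB t)) (sndB (sndB t)))) (H := fun p => p)
    ((ComputableMap.const he).pair (i.snd.snd.pair i.snd.snd)) i fun p hp => ?_
  refine ⟨?_, ?_⟩
  · obtain ⟨_, ⟨_, ha, -, -⟩, -⟩ := hp
    exact nameImpl_nonempty_of ha ⟨p, trivial⟩
  · rintro q ⟨⟨y, hy⟩, -⟩
    simp only [sndB_pair]
    refine ⟨⟨withHead (fun _ => 0) y, ?_⟩, fun z _ j => ⟨pair z j, ?_, trivial⟩⟩
    · simp only [nameMeet, Set.mem_ofPred_eq, fstB_pair, sndB_pair]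
      exact ⟨⟨y, hy⟩, ⟨y, trivial⟩, Or.inl ⟨rfl, hy⟩⟩
    · rw [fstB_pair]
      exact heΦ _ _ (Part.mem_some _)

theorem le_meet_one_impl (a : Baire → Set Baire) :
    NameReducible (nameImpl a nameOne) (nameImpl (nameMeet a nameOne) nameOne) := by
  have i := ComputableMap.id
  obtain ⟨e, he, heΦ⟩ := i
  have i := ComputableMap.id
  refine .mk_total (K := fun t => pair e (fstB (sndB (sndB t)))) (H := fun p => p)
    ((ComputableMap.const he).pair i.snd.snd.fst) i fun p hp => ?_
  refine ⟨?_, ?_⟩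
  · obtain ⟨q, ⟨y, hy⟩, -⟩ := hp
    refine nameImpl_nonempty_of (z := pair (sndB q) y) ⟨withHead (fun _ => 0) y, ?_⟩ ⟨p, trivial⟩
    simp only [nameMeet, Set.mem_ofPred_eq, fstB_pair, sndB_pair]
    exact ⟨⟨y, hy⟩, ⟨y, trivial⟩, Or.inl ⟨rfl, hy⟩⟩
  · rintro q ⟨⟨_, ha, -, -⟩, -⟩
    simp only [sndB_pair]
    refine ⟨by rwa [sndB_pair], fun z _ j => ⟨pair z j, ?_, trivial⟩⟩
    rw [fstB_pair]
    exact heΦ _ _ (Part.mem_some _)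

/-! ## The reductions between degrees -/

theorem dom_eq_empty_iff {X Y : RepSpace} {f : MultiFun X Y} :
    f.dom = ∅ ↔ ∀ p, ¬ (names f p).Nonempty := by
  rw [← not_iff_not, ← ne_eq, ← Set.nonempty_iff_ne_empty, dom_nonempty_iff]
  push Not
  rfl

theorem dom_ne_empty_iff {X Y : RepSpace} {f : MultiFun X Y} :
    f.dom ≠ ∅ ↔ ∃ p, (names f p).Nonempty := by
  rw [← Set.nonempty_iff_ne_empty, dom_nonempty_iff]

theorem dom_impl_eq_empty {X Y U V : RepSpace} {g : MultiFun X Y} {f : MultiFun U V}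
    (hf : f.dom = ∅) : (g.impl f).dom = ∅ := by
  rw [dom_eq_empty_iff] at hf ⊢
  intro p hp
  rw [names_impl] at hp
  exact hf p (nameImpl_nonempty hp)

theorem dom_impl_ne_empty {X Y U V : RepSpace} {g : MultiFun X Y} {f : MultiFun U V}
    (hg : g.dom ≠ ∅) (hf : f.dom ≠ ∅) : (g.impl f).dom ≠ ∅ := by
  rw [dom_ne_empty_iff] at hf hg ⊢
  obtain ⟨x, hx⟩ := hg
  obtain ⟨u, hu⟩ := hf
  rw [names_impl]
  exact ⟨u, nameImpl_nonempty_of hx hu⟩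

theorem dom_star_eq_empty_left {X Y U V : RepSpace} {f : MultiFun U V} (g : MultiFun X Y)
    (hf : f.dom = ∅) : (f.star g).dom = ∅ := by
  rw [dom_eq_empty_iff] at hf ⊢
  intro p hp
  rw [names_star] at hp
  obtain ⟨q, -, y, -, j, r, -, -, h⟩ := hp
  exact hf _ ⟨_, h⟩

theorem dom_star_eq_empty_right {X Y U V : RepSpace} (f : MultiFun U V) {g : MultiFun X Y}
    (hg : g.dom = ∅) : (f.star g).dom = ∅ := by
  rw [dom_eq_empty_iff] at hg ⊢
  intro p hp
  rw [names_star] at hp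
  exact hg _ (nameStar_nonempty_iff.1 hp).1

theorem dom_star_ne_empty {X Y U V : RepSpace} {f : MultiFun U V} {g : MultiFun X Y}
    (hf : f.dom ≠ ∅) (hg : g.dom ≠ ∅) : (f.star g).dom ≠ ∅ := by
  rw [dom_ne_empty_iff] at hf hg ⊢
  obtain ⟨u, hu⟩ := hf
  obtain ⟨x, hx⟩ := hg
  obtain ⟨S, -, hS⟩ := IsComputable.exists_curry ComputableMap.id.fst
  refine ⟨pair (S (pair u u)) x, ?_⟩
  rw [names_star, nameStar_nonempty_iff, fstB_pair, sndB_pair]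
  refine ⟨hx, fun y _ j => ⟨pair u u, ?_, by rwa [sndB_pair]⟩⟩
  exact hS _ _ _ (Part.mem_some_iff.2 (fstB_pair _ _).symm)

theorem dom_meet_eq_empty_left {X Y U V : RepSpace} {f : MultiFun U V} (g : MultiFun X Y)
    (hf : f.dom = ∅) : (f.meet g).dom = ∅ := by
  rw [dom_eq_empty_iff] at hf ⊢
  intro p hp
  rw [names_meet] at hp
  obtain ⟨_, h, -⟩ := hp
  exact hf _ h

theorem dom_meet_eq_empty_right {X Y U V : RepSpace} (f : MultiFun U V) {g : MultiFun X Y}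
    (hg : g.dom = ∅) : (f.meet g).dom = ∅ := by
  rw [dom_eq_empty_iff] at hg ⊢
  intro p hp
  rw [names_meet] at hp
  obtain ⟨_, -, h, -⟩ := hp
  exact hg _ h

theorem dom_meet_ne_empty {X Y U V : RepSpace} {f : MultiFun U V} {g : MultiFun X Y}
    (hf : f.dom ≠ ∅) (hg : g.dom ≠ ∅) : (f.meet g).dom ≠ ∅ := by
  rw [dom_ne_empty_iff] at hf hg ⊢
  obtain ⟨u, v, hu⟩ := hf
  obtain ⟨x, hx⟩ := hg
  refine ⟨pair u x, withHead (fun _ => 0) v, ?_⟩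
  rw [names_meet]
  simp only [nameMeet, Set.mem_ofPred_eq, fstB_pair, sndB_pair]
  exact ⟨⟨v, hu⟩, hx, Or.inl ⟨rfl, hu⟩⟩

theorem dom_coprod_ne_empty_left {X Y U V : RepSpace} {f : MultiFun U V} (g : MultiFun X Y)
    (hf : f.dom ≠ ∅) : (f.coprod g).dom ≠ ∅ := by
  rw [dom_ne_empty_iff] at hf ⊢
  obtain ⟨u, v, hu⟩ := hf
  refine ⟨withHead (fun _ => 0) u, withHead (fun _ => 0) v, ?_⟩
  rw [names_coprod]
  exact Or.inl ⟨rfl, rfl, hu⟩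

theorem dom_coprod_ne_empty_right {X Y U V : RepSpace} (f : MultiFun U V) {g : MultiFun X Y}
    (hg : g.dom ≠ ∅) : (f.coprod g).dom ≠ ∅ := by
  rw [dom_ne_empty_iff] at hg ⊢
  obtain ⟨u, v, hu⟩ := hg
  refine ⟨withHead (fun _ => 1) u, withHead (fun _ => 1) v, ?_⟩
  rw [names_coprod]
  exact Or.inr ⟨rfl, rfl, hu⟩

namespace Problem

theorem le_infty (a : Problem) : a ≤w infty := by cases a <;> trivial

theorem mf_le_mf {X Y U V : RepSpace} {f : MultiFun X Y} {g : MultiFun U V} :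
    mf f ≤w mf g ↔ NameReducible (names f) (names g) := reducible_iff

theorem mf_le_of_dom_eq_empty {X Y : RepSpace} {f : MultiFun X Y} (hf : f.dom = ∅) (a : Problem) :
    mf f ≤w a := by
  cases a with
  | infty => trivial
  | mf g => exact mf_le_mf.2 (.of_empty (dom_eq_empty_iff.1 hf))

theorem le_refl (a : Problem) : a ≤w a := by
  cases a with
  | infty => trivial
  | mf f => exact mf_le_mf.2 (.refl _)

theorem equiv_refl (a : Problem) : a ≡w a := ⟨le_refl a, le_refl a⟩

theorem zero_le (a : Problem) : zero ≤w a :=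
  mf_le_of_dom_eq_empty (Set.eq_empty_of_forall_notMem fun _ ⟨_, h⟩ => h) a

theorem infty_impl (a : Problem) : (infty →w a) = zero := by cases a <;> rfl

theorem mf_impl_mf {X Y U V : RepSpace} {g : MultiFun X Y} (f : MultiFun U V)
    (hg : g.dom ≠ ∅) : (mf g →w mf f) = mf (g.impl f) := by
  simp [impl, hg]

theorem mf_impl_mf_of_dom_eq_empty {X Y U V : RepSpace} (g : MultiFun X Y) {f : MultiFun U V}
    (hf : f.dom = ∅) : (mf g →w mf f) = mf (g.impl f) := by
  simp [impl, hf]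

theorem mf_impl_mf_eq_infty {X Y U V : RepSpace} {g : MultiFun X Y} {f : MultiFun U V}
    (hg : g.dom = ∅) (hf : f.dom ≠ ∅) : (mf g →w mf f) = infty := by
  simp [impl, hg, hf]

theorem star_infty (a : Problem) : a ⋆w infty = infty := by cases a <;> rfl

theorem infty_star (a : Problem) : infty ⋆w a = infty := rfl

theorem prod_infty (a : Problem) : a ×w infty = infty := by cases a <;> rfl

theorem infty_prod (a : Problem) : infty ×w a = infty := rfl

theorem coprod_infty (a : Problem) : a ⊔w infty = infty := by cases a <;> rfl

theorem infty_coprod (a : Problem) : infty ⊔w a = infty := rfl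

theorem meet_infty (a : Problem) : a ⊓w infty = a := by cases a <;> rfl

theorem infty_meet (a : Problem) : infty ⊓w a = a := rfl

theorem impl_impl (a b c : Problem) : (a →w (b →w c)) ≡w ((b ⋆w a) →w c) := by
  obtain f | _ := a
  swap
  · rw [infty_impl, star_infty, infty_impl]
    exact equiv_refl _
  obtain g | _ := b
  swap
  · have h0 : MultiFun.dom (X := oneSpace) (Y := oneSpace) (fun _ => ∅) = ∅ :=
      Set.eq_empty_of_forall_notMem fun _ ⟨_, h⟩ => h
    rw [infty_star, infty_impl, zero, mf_impl_mf_of_dom_eq_empty _ h0]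
    exact ⟨mf_le_of_dom_eq_empty (dom_impl_eq_empty h0) _, mf_le_of_dom_eq_empty h0 _⟩
  obtain h | _ := c
  swap
  · exact equiv_refl _
  change _ ≡w (mf (g.star f) →w mf h)
  by_cases hh : h.dom = ∅
  · rw [mf_impl_mf_of_dom_eq_empty _ hh, mf_impl_mf_of_dom_eq_empty _ (dom_impl_eq_empty hh),
      mf_impl_mf_of_dom_eq_empty _ hh]
    exact ⟨mf_le_of_dom_eq_empty (dom_impl_eq_empty (dom_impl_eq_empty hh)) _,
      mf_le_of_dom_eq_empty (dom_impl_eq_empty hh) _⟩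
  by_cases hg : g.dom = ∅
  · rw [mf_impl_mf_eq_infty hg hh, mf_impl_mf_eq_infty (dom_star_eq_empty_left f hg) hh]
    exact equiv_refl _
  by_cases hf : f.dom = ∅
  · rw [mf_impl_mf _ hg, mf_impl_mf_eq_infty hf (dom_impl_ne_empty hg hh),
      mf_impl_mf_eq_infty (dom_star_eq_empty_right g hf) hh]
    exact equiv_refl _
  rw [mf_impl_mf _ hg, mf_impl_mf _ hf, mf_impl_mf _ (dom_star_ne_empty hg hf)]
  constructor <;> rw [mf_le_mf] <;> simp only [names_impl, names_star]
  · exact impl_impl_le _ _ _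
  · exact le_impl_impl _ _ _

theorem impl_star (a b c : Problem) : (a →w (b ⋆w c)) ≤w ((a →w b) ⋆w c) := by
  obtain f | _ := a
  swap
  · rw [infty_impl]
    exact zero_le _
  obtain g | _ := b
  swap
  · exact le_infty _
  obtain h | _ := c
  swap
  · rw [star_infty (_ →w _)]
    exact le_infty _
  change (mf f →w mf (g.star h)) ≤w _
  by_cases hf : f.dom = ∅
  · by_cases hg : g.dom = ∅
    · rw [mf_impl_mf_of_dom_eq_empty _ (dom_star_eq_empty_left h hg)]
      exact mf_le_of_dom_eq_empty (dom_impl_eq_empty (dom_star_eq_empty_left h hg)) _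
    · rw [mf_impl_mf_eq_infty hf hg]
      exact le_infty _
  rw [mf_impl_mf _ hf, mf_impl_mf _ hf]
  refine mf_le_mf.2 ?_
  simp only [names_impl, names_star]
  exact impl_star_le _ _ _

theorem coprod_impl (a b c : Problem) :
    ((a ⊔w b) →w c) ≤w ((a →w c) ⊓w (b →w c)) := by
  obtain f | _ := a
  swap
  · rw [infty_coprod, infty_impl]
    exact zero_le _
  obtain g | _ := b
  swap
  · rw [coprod_infty, infty_impl]
    exact zero_le _
  obtain h | _ := c
  swap
  · exact le_infty _
  change (mf (f.coprod g) →w mf h) ≤w _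
  by_cases hh : h.dom = ∅
  · rw [mf_impl_mf_of_dom_eq_empty _ hh]
    exact mf_le_of_dom_eq_empty (dom_impl_eq_empty hh) _
  by_cases hf : f.dom = ∅
  · rw [mf_impl_mf_eq_infty hf hh, infty_meet]
    by_cases hg : g.dom = ∅
    · rw [mf_impl_mf_eq_infty hg hh]
      exact le_infty _
    rw [mf_impl_mf _ hg, mf_impl_mf _ (dom_coprod_ne_empty_right f hg)]
    refine mf_le_mf.2 ?_
    simp only [names_impl, names_coprod]
    exact coprod_impl_le_right _ _ (dom_ne_empty_iff.1 hg)
  rw [mf_impl_mf _ hf, mf_impl_mf _ (dom_coprod_ne_empty_left g hf)]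
  by_cases hg : g.dom = ∅
  · rw [mf_impl_mf_eq_infty hg hh, meet_infty]
    refine mf_le_mf.2 ?_
    simp only [names_impl, names_coprod]
    exact coprod_impl_le_left _ _ (dom_ne_empty_iff.1 hf)
  rw [mf_impl_mf _ hg]
  refine mf_le_mf.2 ?_
  simp only [names_impl, names_coprod, names_meet]
  exact coprod_impl_le_meet _ (dom_ne_empty_iff.1 hf) (dom_ne_empty_iff.1 hg)

theorem zero_coprod_le (a : Problem) : zero ⊔w a ≤w a := by
  obtain f | _ := a
  · refine mf_le_mf.2 ?_
    rw [names_coprod]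
    exact coprod_le_of_empty_left _ fun p ⟨_, _, _, _, _, h⟩ => h
  · trivial

theorem coprod_zero_le (a : Problem) : a ⊔w zero ≤w a := by
  obtain f | _ := a
  · refine mf_le_mf.2 ?_
    rw [names_coprod]
    exact coprod_le_of_empty_right _ fun p ⟨_, _, _, _, _, h⟩ => h
  · trivial

theorem impl_coprod_impl (a b c : Problem) :
    ((a →w c) ⊔w (b →w c)) ≤w ((a ⊓w b) →w c) := by
  obtain f | _ := a
  swap
  · rw [infty_meet, infty_impl]
    exact zero_coprod_le _
  obtain g | _ := b
  swap
  · rw [meet_infty, infty_impl]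
    exact coprod_zero_le _
  obtain h | _ := c
  swap
  · exact le_infty _
  change _ ≤w (mf (f.meet g) →w mf h)
  by_cases hh : h.dom = ∅
  · rw [mf_impl_mf_of_dom_eq_empty _ hh, mf_impl_mf_of_dom_eq_empty _ hh]
    refine mf_le_of_dom_eq_empty (dom_eq_empty_iff.2 fun p hp => ?_) _
    rw [names_coprod] at hp
    obtain ⟨_, ⟨-, -, h⟩ | ⟨-, -, h⟩⟩ := hp
    · exact dom_eq_empty_iff.1 (dom_impl_eq_empty hh) _ ⟨_, h⟩
    · exact dom_eq_empty_iff.1 (dom_impl_eq_empty hh) _ ⟨_, h⟩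
  by_cases hf : f.dom = ∅
  · rw [mf_impl_mf_eq_infty (dom_meet_eq_empty_left g hf) hh]
    exact le_infty _
  by_cases hg : g.dom = ∅
  · rw [mf_impl_mf_eq_infty (dom_meet_eq_empty_right f hg) hh]
    exact le_infty _
  rw [mf_impl_mf _ hf, mf_impl_mf _ hg, mf_impl_mf _ (dom_meet_ne_empty hf hg)]
  refine mf_le_mf.2 ?_
  simp only [names_impl, names_coprod, names_meet]
  exact impl_coprod_impl_le _ (dom_ne_empty_iff.1 hf) (dom_ne_empty_iff.1 hg)

theorem prod_star (a b c : Problem) :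
    (a ×w (b ⋆w c)) ≤w ((b ⋆w (a ×w c)) ⊓w ((a ×w b) ⋆w c)) := by
  obtain f | _ := a
  swap
  · rw [infty_prod, infty_prod, infty_prod, infty_star, star_infty]
    exact le_infty _
  obtain g | _ := b
  swap
  · exact le_infty _
  obtain h | _ := c
  swap
  · exact le_infty _
  refine mf_le_mf.2 ?_
  simp only [names_prod, names_star, names_meet]
  exact prod_star_le _ _ _

theorem star_prod_star (a b c d : Problem) :
    ((a ⋆w c) ×w (b ⋆w d)) ≤w ((a ×w b) ⋆w (c ×w d)) := by
  obtain f | _ := a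
  swap
  · exact le_infty _
  obtain g | _ := b
  swap
  · exact le_infty _
  obtain h | _ := c
  swap
  · exact le_infty _
  obtain k | _ := d
  swap
  · exact le_infty _
  refine mf_le_mf.2 ?_
  simp only [names_prod, names_star]
  exact star_prod_star_le _ _ _ _

theorem star_meet_star (a b c d : Problem) (hab : a = infty ↔ b = infty) :
    ((a ⋆w c) ⊓w (b ⋆w d)) ≤w ((a ⊓w b) ⋆w (c ×w d)) := by
  obtain f | _ := a
  swap
  · rw [hab.1 rfl]
    exact le_infty _
  obtain g | _ := b
  swap
  · cases hab.2 rfl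
  obtain h | _ := c
  swap
  · exact le_infty _
  obtain k | _ := d
  swap
  · exact le_infty _
  refine mf_le_mf.2 ?_
  simp only [names_prod, names_star, names_meet]
  exact star_meet_star_le _ _ _ _

theorem dom_one_ne_empty :
    MultiFun.dom (X := oneSpace) (Y := oneSpace) (fun x => {x}) ≠ ∅ :=
  Set.nonempty_iff_ne_empty.1 ⟨(), (), rfl⟩

theorem names_one : names (X := oneSpace) (Y := oneSpace) (fun x => {x}) = nameOne := by
  funext p
  exact Set.eq_univ_of_forall fun q => ⟨(), Part.mem_some _, (), Part.mem_some _, rfl⟩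

theorem impl_one_star (a b : Problem) :
    ((a →w one) ⋆w b) ≡w ((a →w one) ×w b) := by
  obtain g | _ := b
  swap
  · rw [star_infty, prod_infty]
    exact equiv_refl _
  obtain f | _ := a
  swap
  · rw [infty_impl, zero]
    constructor <;> refine mf_le_of_dom_eq_empty (dom_eq_empty_iff.2 fun p hp => ?_) _
    · rw [names_star] at hp
      obtain ⟨q, -, y, -, j, r, -, -, _, _, _, _, h⟩ := hp
      exact h
    · rw [names_prod] at hp
      obtain ⟨q, ⟨_, _, _, _, h⟩, -⟩ := hp
      exact h
  by_cases hf : f.dom = ∅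
  · rw [one, mf_impl_mf_eq_infty hf dom_one_ne_empty]
    exact equiv_refl _
  rw [one, mf_impl_mf _ hf]
  constructor <;> refine mf_le_mf.2 ?_ <;> simp only [names_impl, names_star, names_prod, names_one]
  · exact star_le_prod fun u u' => rfl
  · exact prod_le_star _ _

theorem meet_one_impl_one (a : Problem) (ha : a ≠ infty) :
    ((a ⊓w one) →w one) ≡w (a →w one) := by
  obtain f | _ := a
  swap
  · exact (ha rfl).elim
  change (mf (f.meet _) →w mf _) ≡w (mf f →w mf _)
  by_cases hf : f.dom = ∅
  · rw [mf_impl_mf_eq_infty hf dom_one_ne_empty,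
      mf_impl_mf_eq_infty (dom_meet_eq_empty_left _ hf) dom_one_ne_empty]
    exact equiv_refl _
  rw [mf_impl_mf _ hf, mf_impl_mf _ (dom_meet_ne_empty hf dom_one_ne_empty)]
  constructor <;> refine mf_le_mf.2 ?_ <;> simp only [names_impl, names_meet, names_one]
  · exact meet_one_impl_le _
  · exact le_meet_one_impl _

end Problem

/-! ## Relative computability -/

/-- `x` is computable with oracle `o`. -/
def ComputableFrom (o x : Baire) : Prop := ∃ e, Computable e ∧ x ∈ Phi e o

theorem IsComputable.computableFrom {F : Baire →. Baire} (hF : IsComputable F) {o x : Baire}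
    (hx : x ∈ F o) : ComputableFrom o x := by
  obtain ⟨e, he, h⟩ := hF
  exact ⟨e, he, h _ _ hx⟩

theorem ComputableMap.computableFrom {F : Baire → Baire} (hF : ComputableMap F) (o : Baire) :
    ComputableFrom o (F o) := IsComputable.computableFrom hF (Part.mem_some _)

namespace ComputableFrom

theorem refl (o : Baire) : ComputableFrom o o := ComputableMap.id.computableFrom o

theorem of_computable {x : Baire} (hx : Computable x) (o : Baire) : ComputableFrom o x :=
  (ComputableMap.const hx).computableFrom o

theorem trans {o x y : Baire} (hx : ComputableFrom o x) (hy : ComputableFrom x y) :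
    ComputableFrom o y := by
  obtain ⟨e, he, hx⟩ := hx
  obtain ⟨e', he', hy⟩ := hy
  have h : IsComputable fun q => (Phi e q).bind (Phi e') :=
    IsComputable.bind ⟨e, he, fun _ _ => id⟩ ⟨e', he', fun _ _ => id⟩
  exact h.computableFrom (Part.mem_bind hx hy)

theorem map {F : Baire → Baire} {o x : Baire} (hx : ComputableFrom o x) (hF : ComputableMap F) :
    ComputableFrom o (F x) := hx.trans (hF.computableFrom x)

theorem pair {o x y : Baire} (hx : ComputableFrom o x) (hy : ComputableFrom o y) :
    ComputableFrom o (pair x y) := by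
  obtain ⟨e, he, hx⟩ := hx
  obtain ⟨e', he', hy⟩ := hy
  have h := IsComputable.pair (F := Phi e) (G := Phi e') ⟨e, he, fun _ _ => id⟩
    ⟨e', he', fun _ _ => id⟩
  exact h.computableFrom (Part.mem_bind hx (Part.mem_map _ hy))

theorem fst {o x : Baire} (hx : ComputableFrom o x) : ComputableFrom o (fstB x) :=
  hx.map ComputableMap.id.fst

theorem snd {o x : Baire} (hx : ComputableFrom o x) : ComputableFrom o (sndB x) :=
  hx.map ComputableMap.id.snd

theorem tail {o x : Baire} (hx : ComputableFrom o x) : ComputableFrom o (tailB x) :=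
  hx.map ComputableMap.id.tail

theorem withHead {o x y : Baire} (hx : ComputableFrom o x) (hy : ComputableFrom o y) :
    ComputableFrom o (withHead x y) := by
  have := (hx.pair hy).map (ComputableMap.id.fst.withHead ComputableMap.id.snd)
  simpa only [fstB_pair, sndB_pair] using this

theorem phi {o e x r : Baire} (he : ComputableFrom o e) (hx : ComputableFrom o x)
    (hr : r ∈ Phi e x) : ComputableFrom o r := by
  refine (he.pair hx).trans (IsComputable.computableFrom
    (ComputableMap.id.fst.phi ComputableMap.id.snd) ?_)
  simpa only [fstB_pair, sndB_pair] using hr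

end ComputableFrom

/-! ### Non-computable and Turing incomparable points -/

theorem countable_computable : {e : Baire | Computable e}.Countable := by
  classical
  refine (Set.countable_range fun (c : Nat.Partrec.Code) (n : ℕ) =>
    if h : (c.eval n).Dom then (c.eval n).get h else 0).mono fun e he => ?_
  obtain ⟨c, hc⟩ := Nat.Partrec.Code.exists_code.1 (Partrec.nat_iff.1 (Computable.partrec he))
  refine ⟨c, funext fun n => ?_⟩
  have h : c.eval n = Part.some (e n) := by rw [hc]; rfl
  simp only [h]
  exact dif_pos trivial

theorem countable_computableFrom (o : Baire) : {x | ComputableFrom o x}.Countable := by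
  have : {x | ComputableFrom o x} = ⋃ e ∈ {e : Baire | Computable e}, {x | x ∈ Phi e o} := by
    ext x
    simp [ComputableFrom]
  rw [this]
  refine countable_computable.biUnion fun e _ => Set.Subsingleton.countable ?_
  exact fun x hx y hy => Part.mem_unique hx hy

theorem exists_not_computableFrom (o : Baire) : ∃ x, ¬ ComputableFrom o x := by
  by_contra! h
  have hc : (Set.univ : Set Baire).Countable :=
    (countable_computableFrom o).mono fun x _ => h x
  obtain ⟨f, hf⟩ := hc.exists_eq_range Set.univ_nonempty
  obtain ⟨n, hn⟩ : (fun n => f n n + 1) ∈ Set.range f := hf ▸ Set.mem_univ _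
  exact Nat.succ_ne_self _ (congrFun hn n).symm

/-- One output symbol depends on the finitely many input entries read before it is written. -/
theorem Phi_local {e p q : Baire} (h : q ∈ Phi e p) (n : ℕ) :
    ∃ k, ∀ p', (∀ i < k, p' i = p i) → ∀ q' ∈ Phi e p', q' n = q n := by
  obtain ⟨k, hk, h0⟩ := mem_Phi_iff.1 h n
  refine ⟨k, fun p' hp' q' hq' => ?_⟩
  have hl : ∀ j ≤ k, look e p' n j = look e p n j := by
    intro j hj
    have : initSeg p' j = initSeg p j := List.map_congr_left fun i hi =>
      hp' i ((List.mem_range.1 hi).trans_le hj)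
    rw [look_eq, look_eq, this]
  obtain ⟨k', hk', h0'⟩ := mem_Phi_iff.1 hq' n
  obtain hlt | rfl | hlt := lt_trichotomy k' k
  · have := hl k' hlt.le
    have := h0 k' hlt
    omega
  · have := hl k' le_rfl
    omega
  · have := hl k le_rfl
    have := h0' k hlt
    omega

/-- Near a point of the graph, alter one late entry of the second coordinate. By `Phi_local`, no
input close to the first coordinate can have an output with that altered entry, which excludes a
whole open set. -/
theorem isNowhereDense_graph_Phi (e : Baire) :
    IsNowhereDense {x : Baire × Baire | x.2 ∈ Phi e x.1} := by
  rw [IsNowhereDense, Set.eq_empty_iff_forall_notMem]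
  rintro x hx
  obtain ⟨U, hU, hUo, hxU⟩ := mem_interior.1 hx
  obtain ⟨⟨p, q⟩, hpqU, hpq⟩ := mem_closure_iff.1 (hU hxU) U hUo hxU
  have ht : Filter.Tendsto (fun n => (p, Function.update q n (q n + 1))) Filter.atTop
      (nhds (p, q)) := by
    refine Filter.Tendsto.prodMk_nhds tendsto_const_nhds (tendsto_pi_nhds.2 fun i => ?_)
    refine tendsto_const_nhds.congr' ?_
    filter_upwards [Filter.eventually_gt_atTop i] with n hn
    rw [Function.update_of_ne hn.ne]
  obtain ⟨n, hn⟩ := (ht.eventually (hUo.mem_nhds hpqU)).exists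
  obtain ⟨k, hk⟩ := Phi_local hpq n
  have hVo : IsOpen {x : Baire × Baire | (∀ i < k, x.1 i = p i) ∧ x.2 n ≠ q n} := by
    have h1 : IsOpen {x : Baire × Baire | ∀ i ∈ Finset.range k, x.1 i = p i} := by
      have : {x : Baire × Baire | ∀ i ∈ Finset.range k, x.1 i = p i} =
          ⋂ i ∈ Finset.range k, (fun x : Baire × Baire => x.1 i) ⁻¹' {p i} := by
        ext; simp
      rw [this]
      exact isOpen_biInter_finset fun i _ => (isOpen_discrete _).preimage (by fun_prop)
    have h2 : IsOpen ((fun x : Baire × Baire => x.2 n) ⁻¹' {q n}ᶜ) :=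
      (isOpen_discrete _).preimage (by fun_prop)
    simpa [Set.ext_iff] using! h1.inter h2
  obtain ⟨⟨p', q'⟩, ⟨-, hV, hne⟩, hq'⟩ := mem_closure_iff.1 (hU hn) _ (hUo.inter hVo)
    ⟨hn, fun _ _ => rfl, by simp⟩
  exact hne (hk p' hV q' hq')

/-- There are two Turing incomparable points. -/
theorem exists_incomparable : ∃ p q, ¬ ComputableFrom p q ∧ ¬ ComputableFrom q p := by
  have key : ∀ e : Baire, Dense (closure {x : Baire × Baire | x.2 ∈ Phi e x.1})ᶜ := fun e =>
    interior_eq_empty_iff_dense_compl.1 (isNowhereDense_graph_Phi e)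
  have key' : ∀ e : Baire, Dense (Prod.swap ⁻¹' (closure {x : Baire × Baire | x.2 ∈ Phi e x.1})ᶜ) :=
    fun e => (key e).preimage (Homeomorph.prodComm Baire Baire).isOpenMap
  -- Baire category in the product: there are countably many computable programs, and for each one
  -- the pairs avoiding the closure of its graph in both directions form a dense open set.
  have h1 := dense_biInter_of_isOpen (S := {e : Baire | Computable e})
    (f := fun e => (closure {x : Baire × Baire | x.2 ∈ Phi e x.1})ᶜ ∩
      Prod.swap ⁻¹' (closure {x : Baire × Baire | x.2 ∈ Phi e x.1})ᶜ)
    (fun e _ => isClosed_closure.isOpen_compl.inter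
      (isClosed_closure.isOpen_compl.preimage continuous_swap)) countable_computable
    (fun e _ => (key e).inter_of_isOpen_left (key' e) isClosed_closure.isOpen_compl)
  obtain ⟨⟨p, q⟩, h⟩ := h1.nonempty
  rw [Set.mem_iInter₂] at h
  refine ⟨p, q, fun ⟨e, he, hq⟩ => ?_, fun ⟨e, he, hp⟩ => ?_⟩
  · exact (h e he).1 (subset_closure hq)
  · exact (h e he).2 (subset_closure hp)

/-- Every counterexample uses this: a computable instance gives a computable query, so exhibiting
one weak answer to each such query refutes the reduction. Computability of a point is phrased as
being computable from every oracle. -/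
theorem NameReducible.computableFrom {f g : Baire → Set Baire} (h : NameReducible f g) {p : Baire}
    (hp : ∀ o, ComputableFrom o p) (hf : (f p).Nonempty) :
    ∃ a, (∀ o, ComputableFrom o a) ∧ (g a).Nonempty ∧
      ∀ b ∈ g a, ∃ q ∈ f p, ComputableFrom b q := by
  obtain ⟨k, e, hk, he, h⟩ := h
  obtain ⟨a, ha, hga, hb⟩ := h p hf
  refine ⟨a, fun o => (hp o).trans ⟨e, he, ha⟩, hga, fun b hbg => ?_⟩
  obtain ⟨q, hq, hqf⟩ := hb b hbg
  exact ⟨q, hqf, ((hp b).pair (.refl b)).trans ⟨k, hk, hq⟩⟩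

/-! ## Strictness of the reductions -/

/-- A relation on Baire space, as a multi-valued function between represented spaces. -/
def baireMulti (f : Baire → Set Baire) : MultiFun baireSpace baireSpace := f

theorem names_baire (f : Baire → Set Baire) : names (baireMulti f) = f := by
  funext p
  ext q
  constructor
  · rintro ⟨x, hx, y, hy, h⟩
    obtain rfl := Part.mem_some_iff.1 hx
    obtain rfl := Part.mem_some_iff.1 hy
    exact h
  · exact fun h => ⟨p, Part.mem_some _, q, Part.mem_some _, h⟩

/-- The zero sequence. -/
def zeroSeq : Baire := fun _ => 0

/-- The constant problem with solution `p`. -/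
def constProblem (p : Baire) (_ : Baire) : Set Baire := {p}

namespace Problem

/-- The problem given by a multi-valued function on Baire space. -/
def ofBaire (f : Baire → Set Baire) : Problem := mf (baireMulti f)

theorem proper_ofBaire {f : Baire → Set Baire} {p : Baire} (h : (f p).Nonempty) :
    (ofBaire f).Proper := ⟨p, h⟩

theorem proper_constProblem (p : Baire) : (ofBaire (constProblem p)).Proper :=
  proper_ofBaire (p := p) (Set.singleton_nonempty p)

end Problem

open Problem

theorem computableFrom_zeroSeq (o : Baire) : ComputableFrom o zeroSeq :=
  .of_computable (computable_constSeq 0) o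

/-- The problem that maps `p` to `q` and everything else to `r`. -/
def switchProblem (p q r x : Baire) : Set Baire := {y | (x = p → y = q) ∧ (x ≠ p → y = r)}

theorem switchProblem_nonempty (p q r x : Baire) : (switchProblem p q r x).Nonempty := by
  by_cases h : x = p
  · exact ⟨q, fun _ => rfl, fun h' => (h' h).elim⟩
  · exact ⟨r, fun h' => (h h').elim, fun _ => rfl⟩

/-- The problem without information in its solutions, defined at `p` only. -/
def pointDomain (p x : Baire) : Set Baire := {_y | x = p}

theorem nameStar_nonempty_of {f g : Baire → Set Baire} {e x : Baire} {F : Baire → Baire}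
    (he : ∀ q r, r ∈ Part.some (F q) → r ∈ Phi e q) (hf : ∀ u, (f u).Nonempty)
    (hg : (g x).Nonempty) : (nameStar f g (pair e x)).Nonempty := by
  rw [nameStar_nonempty_iff, fstB_pair, sndB_pair]
  exact ⟨hg, fun y _ j => ⟨_, he _ _ (Part.mem_some _), hf _⟩⟩

theorem nameProd_nonempty {f g : Baire → Set Baire} {p : Baire} (hf : (f (fstB p)).Nonempty)
    (hg : (g (sndB p)).Nonempty) : (nameProd f g p).Nonempty := by
  obtain ⟨x, hx⟩ := hf
  obtain ⟨y, hy⟩ := hg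
  exact ⟨pair x y, by rwa [fstB_pair], by rwa [sndB_pair]⟩

theorem nameMeet_nonempty {f g : Baire → Set Baire} {p : Baire} (hf : (f (fstB p)).Nonempty)
    (hg : (g (sndB p)).Nonempty) : (nameMeet f g p).Nonempty := by
  obtain ⟨x, hx⟩ := hf
  exact ⟨withHead (fun _ => 0) x, ⟨x, hx⟩, hg, Or.inl ⟨rfl, hx⟩⟩

/-- In the product on the left, `p` can be copied into the side information, so every solution
computes `p`. On the right, p is available to the program of the implication as input, so a
computable solution exists. -/
theorem not_star_le_impl {p : Baire} (hp : ¬ ComputableFrom zeroSeq p) :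
    ¬ NameReducible (nameStar (nameImpl (constProblem p) nameOne) (constProblem p))
      (nameImpl (constProblem p) (nameStar nameOne (constProblem p))) := by
  intro h
  have i := ComputableMap.id
  obtain ⟨e, he, heΦ⟩ := i.fst.pair i.fst
  obtain ⟨a, ha, hga, hb⟩ := h.computableFrom (p := pair e zeroSeq)
    (fun o => (ComputableFrom.of_computable he o).pair (computableFrom_zeroSeq o))
    (nameStar_nonempty_of heΦ (fun u => nameImpl_nonempty_of (z := p) ⟨p, rfl⟩ ⟨p, trivial⟩)
      ⟨p, rfl⟩)
  obtain ⟨hne, hst⟩ := nameStar_nonempty_iff.1 (nameImpl_nonempty hga)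
  -- The query `a`, a program with an instance, serves also as its own solution: its program
  -- produces the side information, and any second component solves the trivial problem.
  obtain ⟨q, ⟨-, y, hy, j, r, hr, hqr, -⟩, hq⟩ := hb a ⟨hne, fun y hy j => by
    obtain ⟨r, hr, -⟩ := hst y hy j
    exact ⟨r, hr, hst, y, hy, j, r, hr, rfl, trivial⟩⟩
  rw [fstB_pair] at hr
  obtain rfl : y = p := hy
  obtain rfl := Part.mem_unique hr (heΦ _ _ (Part.mem_some _))
  rw [fstB_pair, fstB_pair] at hqr
  exact hp (hqr ▸ ((ha _).trans hq).fst)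

/-- The problem with solution `q` for instances starting with `0` and `p` for the other ones. -/
def caseProblem (p q u : Baire) : Set Baire := {y | (u 0 = 0 → y = q) ∧ (u 0 ≠ 0 → y = p)}

theorem caseProblem_nonempty (p q u : Baire) : (caseProblem p q u).Nonempty := by
  by_cases h : u 0 = 0
  · exact ⟨q, fun _ => rfl, fun h' => (h' h).elim⟩
  · exact ⟨p, fun h' => (h h').elim, fun _ => rfl⟩

/-- The instances on the left ask for `q` with the help of `p`, and for `p` with the help of `q`;
incomparability rules out computable solutions of either. On the right the summand holding the
required point can be selected. -/
theorem not_meet_le_coprod_impl {p q : Baire} (hpq : ¬ ComputableFrom p q)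
    (hqp : ¬ ComputableFrom q p) :
    ¬ NameReducible (nameMeet (nameImpl (constProblem p) (caseProblem p q))
      (nameImpl (constProblem q) (caseProblem p q)))
      (nameImpl (nameCoprod (constProblem p) (constProblem q)) (caseProblem p q)) := by
  intro h
  have i := ComputableMap.id
  obtain ⟨e, he, heΦ⟩ := i.fst.tail
  obtain ⟨a, ha, -, hb⟩ := h.computableFrom (p := pair zeroSeq fun _ => 1)
    (fun o => (computableFrom_zeroSeq o).pair (.of_computable (computable_constSeq 1) o))
    (nameMeet_nonempty (nameImpl_nonempty_of (z := zeroSeq) ⟨p, rfl⟩ (caseProblem_nonempty _ _ _))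
      (nameImpl_nonempty_of (z := zeroSeq) ⟨q, rfl⟩ (caseProblem_nonempty _ _ _)))
  obtain ⟨b, hba, hbo⟩ : ∃ b ∈ nameImpl (nameCoprod (constProblem p) (constProblem q))
      (caseProblem p q) a, ∀ o, ComputableFrom o b := by
    have hcomp : ∀ n o, ComputableFrom o (pair e (withHead (fun _ => n) zeroSeq)) := fun n o =>
      (ComputableFrom.of_computable he o).pair
        ((ComputableFrom.of_computable (computable_constSeq n) o).withHead
          (computableFrom_zeroSeq o))
    -- The first entry of the query decides which point is wanted, hence which tag to use; removing
    -- the tag then yields the answer.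
    by_cases h0 : a 0 = 0
    · refine ⟨_, ⟨?_, fun y hy j => ?_⟩, hcomp 1⟩
      · rw [sndB_pair]
        exact ⟨withHead (fun _ => 1) q, Or.inr ⟨rfl, rfl, rfl⟩⟩
      · rw [sndB_pair] at hy
        obtain ⟨h1, -, -⟩ | ⟨-, -, hy⟩ := hy
        · cases h1
        · refine ⟨_, (fstB_pair e _).symm ▸ heΦ _ _ (Part.mem_some _), ?_⟩
          change tailB (fstB (pair y j)) ∈ _
          rw [fstB_pair]
          exact ⟨fun _ => hy, fun h => (h h0).elim⟩
    · refine ⟨_, ⟨?_, fun y hy j => ?_⟩, hcomp 0⟩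
      · rw [sndB_pair]
        exact ⟨withHead (fun _ => 0) p, Or.inl ⟨rfl, rfl, rfl⟩⟩
      · rw [sndB_pair] at hy
        obtain ⟨-, -, hy⟩ | ⟨h1, -, -⟩ := hy
        · refine ⟨_, (fstB_pair e _).symm ▸ heΦ _ _ (Part.mem_some _), ?_⟩
          change tailB (fstB (pair y j)) ∈ _
          rw [fstB_pair]
          exact ⟨fun h => (h0 h).elim, fun _ => hy⟩
        · cases h1
  obtain ⟨t, ⟨-, -, ht⟩, hbt⟩ := hb b hba
  simp only [fstB_pair, sndB_pair] at ht
  obtain ⟨-, -, ht⟩ | ⟨-, -, ht⟩ := ht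
  · obtain ⟨r, hr, hc, -⟩ := ht p rfl p
    obtain rfl := hc rfl
    exact hpq (((hbo p).trans hbt).tail.fst.phi ((ComputableFrom.refl p).pair (.refl p)) hr)
  · obtain ⟨r, hr, -, hc⟩ := ht q rfl q
    obtain rfl := hc one_ne_zero
    exact hqp (((hbo q).trans hbt).tail.fst.phi ((ComputableFrom.refl q).pair (.refl q)) hr)

/-- A solution on the left must contain both `p` and `q`, as the domain of the meet consists of ⟨p,
q⟩ alone. The coproduct asks for only one of them. -/
theorem not_meet_impl_le {p q : Baire} (hpq : ¬ ComputableFrom p q)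
    (hqp : ¬ ComputableFrom q p) :
    ¬ NameReducible (nameImpl (nameMeet (pointDomain p) (pointDomain q)) nameOne)
      (nameCoprod (nameImpl (pointDomain p) nameOne) (nameImpl (pointDomain q) nameOne)) := by
  intro h
  obtain ⟨e, he, heΦ⟩ := ComputableMap.id
  obtain ⟨a, ha, hga, hb⟩ := h.computableFrom (p := zeroSeq) computableFrom_zeroSeq
    (nameImpl_nonempty_of (z := pair p q) (nameMeet_nonempty ⟨p, fstB_pair p q⟩
      ⟨q, sndB_pair p q⟩) ⟨p, trivial⟩)
  have hmem : ∀ x, pair e x ∈ nameImpl (pointDomain x) nameOne (tailB a) := fun x =>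
    ⟨⟨x, sndB_pair e x⟩, fun y _ j => ⟨pair y j, by
      rw [fstB_pair]; exact heΦ _ _ (Part.mem_some _), trivial⟩⟩
  have hcomp : ∀ n x, ComputableFrom x (withHead (fun _ => n) (pair e x)) := fun n x =>
    (ComputableFrom.of_computable (computable_constSeq n) x).withHead
      ((ComputableFrom.of_computable he x).pair (.refl x))
  obtain ⟨_, ⟨h0, -, -⟩ | ⟨h1, -, -⟩⟩ := hga
  · obtain ⟨t, ⟨⟨_, -, ⟨_, hq⟩, -⟩, -⟩, hbt⟩ := hb (withHead (fun _ => 0) (pair e p))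
      (Or.inl ⟨h0, rfl, hmem p⟩)
    change sndB (sndB t) = q at hq
    exact hpq (hq ▸ ((hcomp 0 p).trans hbt).snd.snd)
  · obtain ⟨t, ⟨⟨_, ⟨_, hp⟩, -, -⟩, -⟩, hbt⟩ := hb (withHead (fun _ => 1) (pair e q))
      (Or.inr ⟨h1, rfl, hmem q⟩)
    change fstB (sndB t) = p at hp
    exact hqp (hp ▸ ((hcomp 1 q).trans hbt).snd.fst)

/-- Chaining extracts `q` either way on the left: the first problem maps zero to `s`, which the
second maps to `q`; or `p` is fed to the first, giving `q` at once. On the right the first is asked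
something computable, hence not `p`, and the second something computable from `p`, hence not `s`.
The answers `s` and zero, with side information computable from `p`, do not compute `q`. -/
theorem not_meet_star_le_prod_star {p q s : Baire} (hps : ¬ ComputableFrom p s)
    (hsp : ¬ ComputableFrom s p) (hq : ¬ ComputableFrom (pair p s) q) :
    ¬ NameReducible (nameMeet
        (nameStar (switchProblem s q zeroSeq) (nameProd (switchProblem p q s) (constProblem p)))
        (nameStar (nameProd (switchProblem p q s) (switchProblem s q zeroSeq)) (constProblem p)))
      (nameProd (switchProblem p q s) (nameStar (switchProblem s q zeroSeq) (constProblem p))) := by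
  intro h
  have i := ComputableMap.id
  -- `e₁` forwards the answer of the first switch to the second one; `e₂` forwards `p` to both
  -- switches.
  obtain ⟨e₁, he₁, hΦ₁⟩ := i.fst.fst.pair i.fst.fst
  obtain ⟨e₂, he₂, hΦ₂⟩ := i.fst.pair (i.fst.pair i.fst)
  obtain ⟨a, ha, ⟨_, -, hga⟩, hb⟩ := h.computableFrom
    (p := pair (pair e₁ (pair zeroSeq zeroSeq)) (pair e₂ zeroSeq))
    (fun o => ((ComputableFrom.of_computable he₁ o).pair ((computableFrom_zeroSeq o).pair
      (computableFrom_zeroSeq o))).pair ((ComputableFrom.of_computable he₂ o).pair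
      (computableFrom_zeroSeq o)))
    (nameMeet_nonempty
      (by rw [fstB_pair]
          exact nameStar_nonempty_of hΦ₁ (switchProblem_nonempty _ _ _)
            (nameProd_nonempty (switchProblem_nonempty _ _ _ _) ⟨p, rfl⟩))
      (by rw [sndB_pair]
          exact nameStar_nonempty_of hΦ₂ (fun u => nameProd_nonempty
            (switchProblem_nonempty _ _ _ _) (switchProblem_nonempty _ _ _ _)) ⟨p, rfl⟩))
  have hst := (nameStar_nonempty_iff.1 ⟨_, hga⟩).2
  obtain ⟨r, hr, -⟩ := hst p rfl zeroSeq
  have hrp : ComputableFrom p r := (ha p).snd.fst.phi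
    ((ComputableFrom.refl p).pair (computableFrom_zeroSeq p)) hr
  have hrs : sndB r ≠ s := fun h => hps (h ▸ hrp.snd)
  have hap : fstB a ≠ p := fun h => hsp (h ▸ (ha s).fst)
  have hzp : zeroSeq ≠ p := fun h => hsp (h ▸ computableFrom_zeroSeq s)
  obtain ⟨t, ⟨-, -, ht⟩, hbt⟩ := hb (pair s (pair (fstB r) zeroSeq)) (by
    refine ⟨?_, ?_⟩
    · rw [fstB_pair]
      exact ⟨fun h => (hap h).elim, fun _ => rfl⟩
    · rw [sndB_pair]
      refine ⟨hst, p, rfl, zeroSeq, r, hr, fstB_pair _ _, ?_⟩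
      rw [sndB_pair]
      exact ⟨fun h => (hrs h).elim, fun _ => rfl⟩)
  have hop : ComputableFrom (pair p s) p := by
    simpa only [fstB_pair] using (ComputableFrom.refl (pair p s)).fst
  have hos : ComputableFrom (pair p s) s := by
    simpa only [sndB_pair] using (ComputableFrom.refl (pair p s)).snd
  have hot : ComputableFrom (pair p s) t :=
    (hos.pair ((hop.trans hrp.fst).pair (computableFrom_zeroSeq _))).trans hbt
  obtain ⟨-, -, y, hy, j, r', hr', -, hv⟩ | ⟨-, -, y, hy, j, r', hr', -, hv, -⟩ := ht
  · simp only [fstB_pair, sndB_pair] at hy hr'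
    obtain rfl := Part.mem_unique hr' (hΦ₁ _ _ (Part.mem_some _))
    have hys : fstB y = s := hy.1.2 (by rw [fstB_pair]; exact hzp)
    have hvq := hv.1 (by rw [sndB_pair, fstB_pair, hys])
    exact hq (hvq ▸ hot.tail.snd)
  · simp only [fstB_pair, sndB_pair] at hy hr'
    obtain rfl := Part.mem_unique hr' (hΦ₂ _ _ (Part.mem_some _))
    obtain rfl : y = p := hy
    have hvq := hv.1 (by rw [sndB_pair, fstB_pair, fstB_pair])
    exact hq (hvq ▸ hot.tail.snd.fst)

/-- On the left `p`, obtained from the fourth problem, reaches the switch and releases `q`. On the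
right the switch sees only data computed from zero, so everything stays computable from `p`. -/
theorem not_prod_star_prod_le {p q : Baire} (hp : ¬ ComputableFrom zeroSeq p)
    (hq : ¬ ComputableFrom p q) :
    ¬ NameReducible (nameStar (nameProd (switchProblem p q zeroSeq) (constProblem zeroSeq))
        (nameProd (constProblem zeroSeq) (constProblem p)))
      (nameProd (nameStar (switchProblem p q zeroSeq) (constProblem zeroSeq))
        (nameStar (constProblem zeroSeq) (constProblem p))) := by
  intro h
  have i := ComputableMap.id
  obtain ⟨e, he, heΦ⟩ := i.fst.snd.pair (i.fst.snd.pair i.fst.snd)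
  obtain ⟨a, ha, ⟨_, hga, hga'⟩, hb⟩ := h.computableFrom (p := pair e zeroSeq)
    (fun o => (ComputableFrom.of_computable he o).pair (computableFrom_zeroSeq o))
    (nameStar_nonempty_of heΦ (fun u => nameProd_nonempty (switchProblem_nonempty _ _ _ _)
      ⟨zeroSeq, rfl⟩) (nameProd_nonempty ⟨zeroSeq, rfl⟩ ⟨p, rfl⟩))
  have hst := (nameStar_nonempty_iff.1 ⟨_, hga⟩).2
  have hst' := (nameStar_nonempty_iff.1 ⟨_, hga'⟩).2
  obtain ⟨r, hr, -⟩ := hst zeroSeq rfl zeroSeq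
  obtain ⟨r', hr', -⟩ := hst' p rfl zeroSeq
  have hro : ∀ o, ComputableFrom o r := fun o => (ha o).fst.fst.phi
    ((computableFrom_zeroSeq o).pair (computableFrom_zeroSeq o)) hr
  have hrp' : ComputableFrom p r' := (ha p).snd.fst.phi
    ((ComputableFrom.refl p).pair (computableFrom_zeroSeq p)) hr'
  have hrp : sndB r ≠ p := fun h => hp (h ▸ (hro _).snd)
  obtain ⟨t, ⟨-, y, hy, j, r₁, hr₁, -, hv, -⟩, hbt⟩ :=
    hb (pair (pair (fstB r) zeroSeq) (pair (fstB r') zeroSeq)) (by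
      refine ⟨?_, ?_⟩
      · rw [fstB_pair]
        refine ⟨hst, zeroSeq, rfl, zeroSeq, r, hr, fstB_pair _ _, ?_⟩
        rw [sndB_pair]
        exact ⟨fun h => (hrp h).elim, fun _ => rfl⟩
      · rw [sndB_pair]
        exact ⟨hst', p, rfl, zeroSeq, r', hr', fstB_pair _ _, sndB_pair _ _⟩)
  rw [fstB_pair] at hr₁
  obtain rfl := Part.mem_unique hr₁ (heΦ _ _ (Part.mem_some _))
  have hyp : sndB y = p := hy.2
  have hvq := hv.1 (by rw [sndB_pair, fstB_pair, fstB_pair, hyp])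
  have hpt : ComputableFrom p t := (((hro p).fst.pair (computableFrom_zeroSeq p)).pair
    (hrp'.fst.pair (computableFrom_zeroSeq p))).trans hbt
  exact hq (hvq ▸ hpt.snd.fst)

/-- On the left both first-stage problems are always solved, so `p` can be stored as side
information. On the right the meet may answer its first component only, which is computable. -/
theorem not_meet_star_prod_le {p : Baire} (hp : ¬ ComputableFrom zeroSeq p) :
    ¬ NameReducible (nameStar (nameMeet (constProblem zeroSeq) (constProblem zeroSeq))
        (nameProd (constProblem zeroSeq) (constProblem p)))
      (nameMeet (nameStar (constProblem zeroSeq) (constProblem zeroSeq))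
        (nameStar (constProblem zeroSeq) (constProblem p))) := by
  intro h
  have i := ComputableMap.id
  obtain ⟨e, he, heΦ⟩ := i.fst.snd.pair i.fst.snd
  obtain ⟨a, ha, ⟨_, hga, hga', -⟩, hb⟩ := h.computableFrom (p := pair e zeroSeq)
    (fun o => (ComputableFrom.of_computable he o).pair (computableFrom_zeroSeq o))
    (nameStar_nonempty_of heΦ (fun u => nameMeet_nonempty ⟨zeroSeq, rfl⟩ ⟨zeroSeq, rfl⟩)
      (nameProd_nonempty ⟨zeroSeq, rfl⟩ ⟨p, rfl⟩))
  have hst := (nameStar_nonempty_iff.1 hga).2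
  obtain ⟨r, hr, -⟩ := hst zeroSeq rfl zeroSeq
  have hro : ∀ o, ComputableFrom o r := fun o => (ha o).fst.fst.phi
    ((computableFrom_zeroSeq o).pair (computableFrom_zeroSeq o)) hr
  obtain ⟨t, ⟨-, y, hy, j, r₁, hr₁, htr, -⟩, hbt⟩ :=
    hb (withHead zeroSeq (pair (fstB r) zeroSeq)) ⟨hga, hga', Or.inl ⟨rfl, hst, zeroSeq, rfl,
      zeroSeq, r, hr, fstB_pair _ _, sndB_pair _ _⟩⟩
  rw [fstB_pair] at hr₁
  obtain rfl := Part.mem_unique hr₁ (heΦ _ _ (Part.mem_some _))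
  have hyp : sndB y = p := hy.2
  rw [fstB_pair, fstB_pair, hyp] at htr
  have hot : ComputableFrom zeroSeq t := ((computableFrom_zeroSeq _).withHead
    ((hro _).fst.pair (computableFrom_zeroSeq _))).trans hbt
  exact hp (htr ▸ hot.fst)

/-! ### The separating examples as degrees -/

namespace Problem

theorem proper_nameOne : (ofBaire nameOne).Proper := proper_ofBaire (p := zeroSeq) ⟨zeroSeq, trivial⟩

theorem proper_pointDomain (p : Baire) : (ofBaire (pointDomain p)).Proper :=
  proper_ofBaire (p := p) ⟨p, rfl⟩

theorem proper_switchProblem (p q r : Baire) : (ofBaire (switchProblem p q r)).Proper :=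
  proper_ofBaire (switchProblem_nonempty p q r p)

theorem proper_caseProblem (p q : Baire) : (ofBaire (caseProblem p q)).Proper :=
  proper_ofBaire (caseProblem_nonempty p q p)

theorem dom_ne_empty_of_proper {X Y : RepSpace} {f : MultiFun X Y} (h : (mf f).Proper) :
    f.dom ≠ ∅ := Set.nonempty_iff_ne_empty.1 h

theorem impl_star_strict : ∃ a b c : Problem, a.Proper ∧ b.Proper ∧ c.Proper ∧
    ¬ ((a →w b) ⋆w c) ≤w (a →w (b ⋆w c)) := by
  obtain ⟨p, hp⟩ := exists_not_computableFrom zeroSeq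
  refine ⟨ofBaire (constProblem p), ofBaire nameOne, ofBaire (constProblem p),
    proper_constProblem p, proper_nameOne, proper_constProblem p, fun h => not_star_le_impl hp ?_⟩
  have hd := dom_ne_empty_of_proper (proper_constProblem p)
  change ((mf _ →w mf _) ⋆w mf _) ≤w (mf _ →w mf (MultiFun.star _ _)) at h
  rw [mf_impl_mf _ hd, mf_impl_mf _ hd] at h
  simpa only [names_star, names_impl, names_baire] using mf_le_mf.1 h

theorem coprod_impl_strict : ∃ a b c : Problem, a.Proper ∧ b.Proper ∧ c.Proper ∧
    ¬ ((a →w c) ⊓w (b →w c)) ≤w ((a ⊔w b) →w c) := by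
  obtain ⟨p, q, hpq, hqp⟩ := exists_incomparable
  refine ⟨ofBaire (constProblem p), ofBaire (constProblem q), ofBaire (caseProblem p q),
    proper_constProblem p, proper_constProblem q, proper_caseProblem p q,
    fun h => not_meet_le_coprod_impl hpq hqp ?_⟩
  have hp := dom_ne_empty_of_proper (proper_constProblem p)
  have hq := dom_ne_empty_of_proper (proper_constProblem q)
  change ((mf _ →w mf _) ⊓w (mf _ →w mf _)) ≤w (mf (MultiFun.coprod _ _) →w mf _) at h
  rw [mf_impl_mf _ hp, mf_impl_mf _ hq, mf_impl_mf _ (dom_coprod_ne_empty_left _ hp)] at h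
  simpa only [names_meet, names_coprod, names_impl, names_baire] using mf_le_mf.1 h

theorem impl_coprod_impl_strict : ∃ a b c : Problem, a.Proper ∧ b.Proper ∧ c.Proper ∧
    ¬ ((a ⊓w b) →w c) ≤w ((a →w c) ⊔w (b →w c)) := by
  obtain ⟨p, q, hpq, hqp⟩ := exists_incomparable
  refine ⟨ofBaire (pointDomain p), ofBaire (pointDomain q), ofBaire nameOne,
    proper_pointDomain p, proper_pointDomain q, proper_nameOne,
    fun h => not_meet_impl_le hpq hqp ?_⟩
  have hp := dom_ne_empty_of_proper (proper_pointDomain p)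
  have hq := dom_ne_empty_of_proper (proper_pointDomain q)
  change (mf (MultiFun.meet _ _) →w mf _) ≤w ((mf _ →w mf _) ⊔w (mf _ →w mf _)) at h
  rw [mf_impl_mf _ hp, mf_impl_mf _ hq, mf_impl_mf _ (dom_meet_ne_empty hp hq)] at h
  simpa only [names_meet, names_coprod, names_impl, names_baire] using mf_le_mf.1 h

theorem prod_star_strict : ∃ a b c : Problem, a.Proper ∧ b.Proper ∧ c.Proper ∧
    ¬ ((b ⋆w (a ×w c)) ⊓w ((a ×w b) ⋆w c)) ≤w (a ×w (b ⋆w c)) := by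
  obtain ⟨p, s, hps, hsp⟩ := exists_incomparable
  obtain ⟨q, hq⟩ := exists_not_computableFrom (pair p s)
  refine ⟨ofBaire (switchProblem p q s), ofBaire (switchProblem s q zeroSeq),
    ofBaire (constProblem p), proper_switchProblem _ _ _, proper_switchProblem _ _ _,
    proper_constProblem p, fun h => not_meet_star_le_prod_star hps hsp hq ?_⟩
  simpa only [names_meet, names_prod, names_star, names_baire] using mf_le_mf.1 h

theorem star_prod_star_strict : ∃ a b c d : Problem,
    a.Proper ∧ b.Proper ∧ c.Proper ∧ d.Proper ∧
    ¬ ((a ×w b) ⋆w (c ×w d)) ≤w ((a ⋆w c) ×w (b ⋆w d)) := by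
  obtain ⟨p, hp⟩ := exists_not_computableFrom zeroSeq
  obtain ⟨q, hq⟩ := exists_not_computableFrom p
  refine ⟨ofBaire (switchProblem p q zeroSeq), ofBaire (constProblem zeroSeq),
    ofBaire (constProblem zeroSeq), ofBaire (constProblem p), proper_switchProblem _ _ _,
    proper_constProblem _, proper_constProblem _, proper_constProblem _,
    fun h => not_prod_star_prod_le hp hq ?_⟩
  simpa only [names_prod, names_star, names_baire] using mf_le_mf.1 h

theorem star_meet_star_strict : ∃ a b c d : Problem,
    a.Proper ∧ b.Proper ∧ c.Proper ∧ d.Proper ∧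
    ¬ ((a ⊓w b) ⋆w (c ×w d)) ≤w ((a ⋆w c) ⊓w (b ⋆w d)) := by
  obtain ⟨p, hp⟩ := exists_not_computableFrom zeroSeq
  refine ⟨ofBaire (constProblem zeroSeq), ofBaire (constProblem zeroSeq),
    ofBaire (constProblem zeroSeq), ofBaire (constProblem p), proper_constProblem _,
    proper_constProblem _, proper_constProblem _, proper_constProblem _,
    fun h => not_meet_star_prod_le hp ?_⟩
  simpa only [names_meet, names_prod, names_star, names_baire] using mf_le_mf.1 h

end Problem

end Weihrauch

open Weihrauch in
theorem proposition38 :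
    (∀ a b c : Problem, (a →w (b →w c)) ≡w ((b ⋆w a) →w c)) ∧
    ((∀ a b c : Problem, (a →w (b ⋆w c)) ≤w ((a →w b) ⋆w c)) ∧
      (∃ a b c : Problem, a.Proper ∧ b.Proper ∧ c.Proper ∧
        ¬ ((a →w b) ⋆w c) ≤w (a →w (b ⋆w c)))) ∧
    ((∀ a b c : Problem, ((a ⊔w b) →w c) ≤w ((a →w c) ⊓w (b →w c))) ∧
      (∃ a b c : Problem, a.Proper ∧ b.Proper ∧ c.Proper ∧
        ¬ ((a →w c) ⊓w (b →w c)) ≤w ((a ⊔w b) →w c))) ∧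
    ((∀ a b c : Problem, ((a →w c) ⊔w (b →w c)) ≤w ((a ⊓w b) →w c)) ∧
      (∃ a b c : Problem, a.Proper ∧ b.Proper ∧ c.Proper ∧
        ¬ ((a ⊓w b) →w c) ≤w ((a →w c) ⊔w (b →w c)))) ∧
    ((∀ a b c : Problem, (a ×w (b ⋆w c)) ≤w ((b ⋆w (a ×w c)) ⊓w ((a ×w b) ⋆w c))) ∧
      (∃ a b c : Problem, a.Proper ∧ b.Proper ∧ c.Proper ∧
        ¬ ((b ⋆w (a ×w c)) ⊓w ((a ×w b) ⋆w c)) ≤w (a ×w (b ⋆w c)))) ∧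
    ((∀ a b c d : Problem, ((a ⋆w c) ×w (b ⋆w d)) ≤w ((a ×w b) ⋆w (c ×w d))) ∧
      (∃ a b c d : Problem, a.Proper ∧ b.Proper ∧ c.Proper ∧ d.Proper ∧
        ¬ ((a ×w b) ⋆w (c ×w d)) ≤w ((a ⋆w c) ×w (b ⋆w d)))) ∧
    ((∀ a b c d : Problem, (a = Problem.infty ↔ b = Problem.infty) →
        ((a ⋆w c) ⊓w (b ⋆w d)) ≤w ((a ⊓w b) ⋆w (c ×w d))) ∧
      (∃ a b c d : Problem, a.Proper ∧ b.Proper ∧ c.Proper ∧ d.Proper ∧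
        ¬ ((a ⊓w b) ⋆w (c ×w d)) ≤w ((a ⋆w c) ⊓w (b ⋆w d)))) ∧
    (∀ a b : Problem, ((a →w Problem.one) ⋆w b) ≡w ((a →w Problem.one) ×w b)) ∧
    (∀ a : Problem, a ≠ Problem.infty →
      ((a ⊓w Problem.one) →w Problem.one) ≡w (a →w Problem.one)) :=
  ⟨Problem.impl_impl, ⟨Problem.impl_star, Problem.impl_star_strict⟩,
    ⟨Problem.coprod_impl, Problem.coprod_impl_strict⟩,
    ⟨Problem.impl_coprod_impl, Problem.impl_coprod_impl_strict⟩,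
    ⟨Problem.prod_star, Problem.prod_star_strict⟩,
    ⟨Problem.star_prod_star, Problem.star_prod_star_strict⟩,
    ⟨Problem.star_meet_star, Problem.star_meet_star_strict⟩, Problem.impl_one_star,
    Problem.meet_one_impl_one⟩
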